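/- All graphs are finite and simple; subsets of vertices are identified with the subgraphs they generate, and $S(x)$ denotes the unit sphere of $x$, the graph generated by the neighbours of $x$. A graph is contractible if it is $K_1$ or has a vertex $x$ such that $G-x$ and $S(x)$ are contractible. The empty graph is the $(-1)$-sphere; for $d\ge 0$ a graph $G$ is a $d$-sphere if all its unit spheres are $(d-1)$-spheres and $G-x$ is contractible for some vertex $x$. A $d$-ball is a graph $H-x$ with $H$ a $d$-sphere and $x$ a vertex of $H$. A vertex $y$ of a $2$-ball is interior if $S(y)$ is a $1$-sphere (a cyclic graph), and a boundary vertex if $S(y)$ is a $1$-ball (a path graph). The boundary length is the number of boundary vertices. An edge is interior if not both of its end points are boundary vertices. Let $G$ be a $2$-ball in which every interior vertex has even degree. One step of the billiard sends a directed edge $(x,y)$ to $(y,z)$, where $z$ is the antipode of $x$ in the (even) cycle $S(y)$ if $y$ is interior, and the mirror image of $x$ under the reflection of the path $S(y)$ exchanging its end points if $y$ is a boundary vertex. A billiard orbit is an orbit, as a set of directed edges, of a directed interior edge (so the boundary itself is not counted). It is undirected (self-backtracking) if with each directed edge it also contains the reversed one. The billiard is ergodic if some billiard orbit visits every interior edge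 exactly once, i.e. contains, for each interior edge, exactly one of its two orientations. Then: (1) the billiard step is a well-defined permutation of the set of directed edges of $G$; (2) if the boundary length of $G$ is not divisible by $3$, then there is at least one undirected billiard orbit, and the billiard is not ergodic; (3) the number of undirected billiard orbits is equal to half the number of boundary vertices of odd degree. -/

import Mathlib

open SimpleGraph

/-- `ContractibleOn G S`: the subgraph of `G` generated by the vertex set `S` is contractible:
it is a one-point graph, or it has a vertex `x` such that both the graph with `x` removed and the
unit sphere of `x` (the graph generated by the neighbours of `x`) are contractible. -/
inductive ContractibleOn {V : Type*} (G : SimpleGraph V) : Set V → Prop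
  | point (x : V) : ContractibleOn G {x}
  | step (S : Set V) (x : V) (hx : x ∈ S) (hdel : ContractibleOn G (S \ {x}))
      (hsph : ContractibleOn G (S ∩ G.neighborSet x)) : ContractibleOn G S

/-- `SphereOn G n S`: the subgraph of `G` generated by the vertex set `S` is an `(n - 1)`-sphere.
The `(-1)`-sphere is the empty graph; a graph is an `n`-sphere if all its unit spheres are
`(n - 1)`-spheres and removing some vertex leaves a contractible graph. -/
def SphereOn {V : Type*} (G : SimpleGraph V) : ℕ → Set V → Prop
  | 0, S => S = ∅
  | n + 1, S => (∀ x ∈ S, SphereOn G n (S ∩ G.neighborSet x)) ∧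
      ∃ x ∈ S, ContractibleOn G (S \ {x})

/-- The graph `G` is a `d`-sphere. -/
def IsGraphSphere {V : Type*} (d : ℕ) (G : SimpleGraph V) : Prop :=
  SphereOn G (d + 1) Set.univ

/-- The graph `G` is a `d`-ball: it is obtained from some `d`-sphere `H` by removing a vertex
(the removed vertex is `none`, the others are the vertices of `G`). -/
def IsGraphBall {V : Type*} (d : ℕ) (G : SimpleGraph V) : Prop :=
  ∃ H : SimpleGraph (Option V), IsGraphSphere d H ∧ H.comap some = G

/-- The unit sphere of `y`: the graph generated by the neighbours of `y`. -/
abbrev unitSphere {V : Type*} (G : SimpleGraph V) (y : V) : SimpleGraph (G.neighborSet y) :=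
  G.induce (G.neighborSet y)

/-- Interior vertices of a 2-ball: the unit sphere is a 1-sphere. -/
def interiorVertices {V : Type*} (G : SimpleGraph V) : Set V :=
  {y | IsGraphSphere 1 (unitSphere G y)}

/-- Boundary vertices of a 2-ball: the unit sphere is a 1-ball. -/
def boundaryVertices {V : Type*} (G : SimpleGraph V) : Set V :=
  {y | IsGraphBall 1 (unitSphere G y)}

/-- The number of neighbours of `y`. -/
noncomputable def vertexDegree {V : Type*} (G : SimpleGraph V) (y : V) : ℕ :=
  (G.neighborSet y).ncard

/-- The boundary length of a 2-ball, the length of the cyclic graph generated by the boundary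
vertices, i.e. their number. -/
noncomputable def boundaryLength {V : Type*} (G : SimpleGraph V) : ℕ :=
  (boundaryVertices G).ncard

/-- `x` and `z` are opposite in a cyclic graph of even length `2 * n`. -/
def AntipodalInCycle {W : Type*} (C : SimpleGraph W) (x z : W) : Prop :=
  ∃ (n : ℕ) (e : C ≃g cycleGraph (2 * n)),
    (e z : ℕ) = (e x : ℕ) + n ∨ (e x : ℕ) = (e z : ℕ) + n

/-- `z` is the mirror image of `x` in a path graph: the reflection which exchanges the two end
points of the path sends `x` to `z`. -/
def MirrorInPath {W : Type*} (P : SimpleGraph W) (x z : W) : Prop :=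
  ∃ (n : ℕ) (e : P ≃g pathGraph n), (e x : ℕ) + (e z : ℕ) + 1 = n

/-- One step of the billiard on directed edges: the ray `(x, y)` is continued by the ray `(y, z)`,
where `z` is opposite to `x` in the unit sphere of `y` if `y` is an interior vertex, and the mirror
image of `x` in the unit sphere of `y` if `y` is a boundary vertex. -/
def BilliardStep {V : Type*} (G : SimpleGraph V) (a b : G.Dart) : Prop :=
  ∃ (x y z : V) (hxy : G.Adj x y) (hyz : G.Adj y z), a = ⟨(x, y), hxy⟩ ∧ b = ⟨(y, z), hyz⟩ ∧
    ((y ∈ interiorVertices G ∧ AntipodalInCycle (unitSphere G y) ⟨x, hxy.symm⟩ ⟨z, hyz⟩) ∨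
     (y ∈ boundaryVertices G ∧ MirrorInPath (unitSphere G y) ⟨x, hxy.symm⟩ ⟨z, hyz⟩))

/-- An interior edge: not both end points are in the boundary. -/
def IsInteriorEdge {V : Type*} (G : SimpleGraph V) (e : Sym2 V) : Prop :=
  e ∈ G.edgeSet ∧ ∃ v ∈ e, v ∉ boundaryVertices G

/-- All directed edges visited by the billiard started with the directed edge `a`. -/
def orbitOf {V : Type*} (G : SimpleGraph V) (a : G.Dart) : Set G.Dart :=
  {b | Relation.ReflTransGen (BilliardStep G) a b}

/-- The billiard orbits: the orbits through interior edges. (The boundary of the table is not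
counted as a billiard orbit.) -/
def billiardOrbits {V : Type*} (G : SimpleGraph V) : Set (Set G.Dart) :=
  {O | ∃ a : G.Dart, IsInteriorEdge G a.edge ∧ O = orbitOf G a}

/-- The undirected (self-backtracking) billiard orbits: those which run through each of their edges
in both directions. -/
def undirectedOrbits {V : Type*} (G : SimpleGraph V) : Set (Set G.Dart) :=
  {O | O ∈ billiardOrbits G ∧ ∀ a ∈ O, a.symm ∈ O}

/-- The billiard is ergodic: some billiard orbit visits every interior edge exactly once
(in one of its two directions). -/
def IsErgodicBilliard {V : Type*} (G : SimpleGraph V) : Prop :=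
  ∃ O ∈ billiardOrbits G, ∀ e : Sym2 V, IsInteriorEdge G e → ∃! a : G.Dart, a ∈ O ∧ a.edge = e

/-! Write the ball as `G = H - o` with `H` a 2-sphere (`o` is `none`); its boundary vertices are the
neighbours of `o`, and unit spheres in `H` are cycles.

Antipode and mirror image are involutions of each unit sphere, so the step is a permutation `φ` of
the directed edges which edge reversal `r` conjugates to its inverse
(`IsGraphBall.exists_billiardPerm`). An orbit stable under `r` is a cycle of `φ` on which `r` acts
as a reflection without fixed points, hence contains exactly two edges with `φ a = r a`
(`two_mul_ncard_reversed_orbits`). Such an edge hits a boundary vertex of odd degree coming from the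
middle of its path, and each such vertex has exactly one; this gives (3).

For (2), suppose there is no undirected orbit. By (3) all degrees in `G` are even, so the edges of
`G` form a mod 2 cycle in `H`. First homology of `H` vanishes, so this cycle bounds a set of
triangles, which can be chosen to avoid `o`; each edge of `G` then lies in exactly one of them, so 3
divides the number of edges of `G`. Counting all triangles, 3 divides the number of edges of `H`.
The difference is the degree of `o`, the boundary length. Finally, an ergodic orbit would meet,
hence equal, an undirected one, and so contain both directions of an edge. -/

/-! ### Contractibility and spheres under pullback. -/

theorem ContractibleOn.nonempty {V : Type*} {G : SimpleGraph V} {S : Set V}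
    (h : ContractibleOn G S) : S.Nonempty := by
  cases h with
  | point x => exact ⟨x, rfl⟩
  | step x hx => exact ⟨_, by assumption⟩

/-- Contractibility of the image of an injective map pulls back to the induced graph. -/
theorem ContractibleOn.of_image {V W : Type*} {H : SimpleGraph W} {f : V → W}
    (hf : Function.Injective f) {T : Set W} (h : ContractibleOn H T) :
    ∀ S : Set V, f '' S = T → ContractibleOn (H.comap f) S := by
  induction h with
  | point x =>
    intro S hS
    obtain ⟨a, ha, rfl⟩ : x ∈ f '' S := by rw [hS]; rfl
    have : S = {a} := by
      ext b
      constructor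
      · intro hb
        have : f b ∈ ({f a} : Set W) := hS ▸ Set.mem_image_of_mem f hb
        exact hf this
      · rintro rfl; exact ha
    rw [this]; exact .point a
  | step T x hx hdel hsph ih1 ih2 =>
    intro S hS
    obtain ⟨a, ha, rfl⟩ : x ∈ f '' S := by rw [hS]; exact hx
    refine .step S a ha (ih1 _ ?_) (ih2 _ ?_)
    · rw [Set.image_sdiff hf, hS, Set.image_singleton]
    · ext w
      simp only [Set.mem_image, Set.mem_inter_iff, mem_neighborSet, comap_adj, ← hS]
      constructor
      · rintro ⟨b, ⟨hb, hab⟩, rfl⟩; exact ⟨⟨b, hb, rfl⟩, hab⟩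
      · rintro ⟨⟨b, hb, rfl⟩, hab⟩; exact ⟨b, ⟨hb, hab⟩, rfl⟩

theorem SphereOn.of_image {V W : Type*} {H : SimpleGraph W} {f : V → W}
    (hf : Function.Injective f) {n : ℕ} : ∀ {S : Set V}, SphereOn H n (f '' S) →
    SphereOn (H.comap f) n S := by
  induction n with
  | zero => intro S h; simpa [SphereOn] using h
  | succ n ih =>
    rintro S ⟨h1, x, ⟨a, ha, rfl⟩, h2⟩
    refine ⟨fun b hb => ih ?_, a, ha, h2.of_image hf _ ?_⟩
    · convert h1 (f b) ⟨b, hb, rfl⟩ using 1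
      ext w
      simp only [Set.mem_image, Set.mem_inter_iff, mem_neighborSet, comap_adj]
      constructor
      · rintro ⟨b, ⟨hb, hab⟩, rfl⟩; exact ⟨⟨b, hb, rfl⟩, hab⟩
      · rintro ⟨⟨b, hb, rfl⟩, hab⟩; exact ⟨b, ⟨hb, hab⟩, rfl⟩
    · rw [Set.image_sdiff hf, Set.image_singleton]

/-! ### One-dimensional spheres are cycles. -/

/-- A zero-dimensional sphere consists of two non-adjacent vertices. -/
theorem SphereOn.exists_pair {V : Type*} {G : SimpleGraph V} {S : Set V} (h : SphereOn G 1 S) :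
    ∃ a b, a ≠ b ∧ ¬ G.Adj a b ∧ S = {a, b} := by
  obtain ⟨h1, x, hx, h2⟩ := h
  -- A contractible graph with more than one vertex contains an edge, but here all unit spheres are
  -- empty.
  have key : ∃ b, S \ {x} = {b} := by
    generalize hT : S \ {x} = T at h2
    cases h2 with
    | point b => exact ⟨b, rfl⟩
    | step S' y hy hdel hsph =>
      obtain ⟨z, hz, hyz⟩ := hsph.nonempty
      rw [← hT] at hy hz
      have : S ∩ G.neighborSet y = ∅ := h1 y hy.1
      exact absurd (show z ∈ S ∩ G.neighborSet y from ⟨hz.1, hyz⟩) (by simp [this])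
  obtain ⟨b, hb⟩ := key
  have hbS : b ∈ S \ {x} := by rw [hb]; rfl
  refine ⟨x, b, fun h => hbS.2 h.symm, fun hadj => ?_, ?_⟩
  · have : S ∩ G.neighborSet x = ∅ := h1 x hx
    exact absurd (show b ∈ S ∩ G.neighborSet x from ⟨hbS.1, hadj⟩) (by simp [this])
  · rw [show ({x, b} : Set V) = insert x (S \ {x}) by rw [hb], Set.insert_sdiff_singleton,
      Set.insert_eq_of_mem hx]

/-- A contractible graph in which every vertex has at most two neighbours, pairwise not adjacent,
is a path. -/
theorem ContractibleOn.exists_path {V : Type*} {G : SimpleGraph V} {S : Set V}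
    (h : ContractibleOn G S)
    (h2 : ∀ x ∈ S, ∀ a ∈ S, ∀ b ∈ S, ∀ c ∈ S, G.Adj x a → G.Adj x b → G.Adj x c →
      a = b ∨ a = c ∨ b = c)
    (h3 : ∀ x ∈ S, ∀ a ∈ S, ∀ b ∈ S, G.Adj x a → G.Adj x b → ¬ G.Adj a b) :
    ∃ (n : ℕ) (f : ℕ → V), (∀ i ≤ n, ∀ j ≤ n, f i = f j → i = j) ∧ S = f '' {i | i ≤ n} ∧
      ∀ i ≤ n, ∀ j ≤ n, (G.Adj (f i) (f j) ↔ i + 1 = j ∨ j + 1 = i) := by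
  induction h with
  | point x =>
    refine ⟨0, fun _ => x, by omega, ?_, ?_⟩
    · ext y; simp [eq_comm]
    · intro i hi j hj; simp; omega
  | step S x hx hdel hsph ih1 ih2 =>
    clear ih2
    obtain ⟨n, f, finj, fS, fadj⟩ := ih1
      (fun y hy a ha b hb c hc => h2 y hy.1 a ha.1 b hb.1 c hc.1)
      (fun y hy a ha b hb => h3 y hy.1 a ha.1 b hb.1)
    have hfS : ∀ i ≤ n, f i ∈ S ∧ f i ≠ x := by
      intro i hi
      have : f i ∈ S \ {x} := by rw [fS]; exact ⟨i, hi, rfl⟩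
      exact this
    -- the link of `x` is a single vertex
    obtain ⟨l, hl⟩ : ∃ l, S ∩ G.neighborSet x = {l} := by
      generalize hT : S ∩ G.neighborSet x = T at hsph
      cases hsph with
      | point b => exact ⟨b, rfl⟩
      | step S' y hy hdel hsph =>
        obtain ⟨z, hz, hyz⟩ := hsph.nonempty
        rw [← hT] at hy hz
        exact absurd hyz (h3 x hx y hy.1 z hz.1 hy.2 hz.2)
    have hlx : ∀ y ∈ S, G.Adj x y ↔ y = l := by
      intro y hy
      have := Set.ext_iff.1 hl y
      simpa [hy] using this
    have hl' : l ∈ S ∩ G.neighborSet x := by rw [hl]; rfl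
    have hlS : l ∈ S \ {x} := ⟨hl'.1, fun h => G.ne_of_adj hl'.2 h.symm⟩
    obtain ⟨k, hk, rfl⟩ : l ∈ f '' {i | i ≤ n} := fS ▸ hlS
    have hk : k ≤ n := hk
    -- An inner vertex of the path has two neighbours already; `x` would be a third.
    have hend : k = 0 ∨ k = n := by
      by_contra hcon
      push Not at hcon
      have e1 := (fadj k hk (k - 1) (by omega)).2 (by omega)
      have e2 := (fadj k hk (k + 1) (by omega)).2 (by omega)
      rcases h2 (f k) hl'.1 x hx _ (hfS (k - 1) (by omega)).1 _ (hfS (k + 1) (by omega)).1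
        hl'.2.symm e1 e2 with h | h | h
      · exact (hfS _ (by omega)).2 h.symm
      · exact (hfS _ (by omega)).2 h.symm
      · have := finj _ (by omega) _ (by omega) h; omega
    -- orient the path so that it ends at the neighbour of `x`
    obtain ⟨g, ginj, gS, gadj, gl⟩ : ∃ g : ℕ → V, (∀ i ≤ n, ∀ j ≤ n, g i = g j → i = j) ∧
        S \ {x} = g '' {i | i ≤ n} ∧
        (∀ i ≤ n, ∀ j ≤ n, (G.Adj (g i) (g j) ↔ i + 1 = j ∨ j + 1 = i)) ∧ g n = f k := by
      by_cases hkn : k = n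
      · exact ⟨f, finj, fS, fadj, by rw [hkn]⟩
      have hk0 : k = 0 := by omega
      refine ⟨fun i => f (n - i), ?_, ?_, ?_, by simp [hk0]⟩
      · intro i hi j hj h
        have := finj _ (by omega) _ (by omega) h; omega
      · rw [fS]; ext y; simp only [Set.mem_image, Set.mem_ofPred_eq]
        constructor
        · rintro ⟨i, hi, rfl⟩; exact ⟨n - i, by omega, by congr 1; omega⟩
        · rintro ⟨i, hi, rfl⟩; exact ⟨n - i, by omega, rfl⟩
      · intro i hi j hj
        rw [fadj _ (by omega) _ (by omega)]; omega
    have hgS : ∀ i ≤ n, g i ∈ S ∧ g i ≠ x := by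
      intro i hi
      have : g i ∈ S \ {x} := by rw [gS]; exact ⟨i, hi, rfl⟩
      exact this
    have gx : ∀ i ≤ n, (G.Adj x (g i) ↔ i = n) := by
      intro i hi
      rw [hlx _ (hgS i hi).1, ← gl]
      exact ⟨fun h => ginj _ hi _ le_rfl h, fun h => by rw [h]⟩
    refine ⟨n + 1, fun i => if i ≤ n then g i else x, ?_, ?_, ?_⟩
    · intro i hi j hj h
      by_cases hi' : i ≤ n <;> by_cases hj' : j ≤ n <;> simp only [hi', hj', if_true, if_false] at h
      · exact ginj _ hi' _ hj' h
      · exact absurd h (hgS i hi').2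
      · exact absurd h.symm (hgS j hj').2
      · omega
    · rw [← Set.insert_eq_of_mem hx, ← Set.insert_sdiff_singleton, gS]
      ext y
      simp only [Set.mem_insert_iff, Set.mem_image, Set.mem_ofPred_eq]
      constructor
      · rintro (rfl | ⟨i, hi, rfl⟩)
        · exact ⟨n + 1, le_rfl, by simp⟩
        · exact ⟨i, by omega, by simp [hi]⟩
      · rintro ⟨i, hi, rfl⟩
        by_cases hi' : i ≤ n
        · right; exact ⟨i, hi', by simp [hi']⟩
        · left; simp [hi']
    · intro i hi j hj
      by_cases hi' : i ≤ n <;> by_cases hj' : j ≤ n <;> simp only [hi', hj', if_true, if_false]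
      · exact gadj _ hi' _ hj'
      · rw [G.adj_comm, gx i hi']; omega
      · rw [gx j hj']; omega
      · simp; omega

/-- The vertices of `C` are labelled by `ZMod n` such that edges join successive labels. -/
def IsCycleLabel {W : Type*} (C : SimpleGraph W) {n : ℕ} (e : W ≃ ZMod n) : Prop :=
  ∀ a b, C.Adj a b ↔ e a - e b = 1 ∨ e b - e a = 1

/-- A one-dimensional sphere is a cycle of length at least four. -/
theorem exists_isCycleLabel {W : Type*} {C : SimpleGraph W} (h : IsGraphSphere 1 C) :
    ∃ (n : ℕ) (_ : 4 ≤ n) (e : W ≃ ZMod n), IsCycleLabel C e := by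
  obtain ⟨h1, x, -, h2⟩ := h
  have h1' : ∀ y, ∃ a b, a ≠ b ∧ ¬ C.Adj a b ∧ ∀ z, C.Adj y z ↔ z = a ∨ z = b := by
    intro y
    obtain ⟨a, b, hab, hn, hS⟩ := (h1 y trivial).exists_pair
    refine ⟨a, b, hab, hn, fun z => ?_⟩
    simpa using Set.ext_iff.1 hS z
  obtain ⟨n, f, finj, fS, fadj⟩ := h2.exists_path
    (by
      intro y _ a _ b _ c _ ha hb hc
      obtain ⟨p, q, -, -, hpq⟩ := h1' y
      rw [hpq] at ha hb hc
      rcases ha with rfl | rfl <;> rcases hb with rfl | rfl <;> rcases hc with rfl | rfl <;> simp)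
    (by
      intro y _ a _ b _ ha hb
      obtain ⟨p, q, -, hn, hpq⟩ := h1' y
      rw [hpq] at ha hb
      rcases ha with rfl | rfl <;> rcases hb with rfl | rfl
      · simp
      · exact hn
      · exact fun h => hn h.symm
      · simp)
  have fx : ∀ i ≤ n, f i ≠ x := by
    intro i hi
    have : f i ∈ Set.univ \ {x} := by rw [fS]; exact ⟨i, hi, rfl⟩
    exact this.2
  have fsurj : ∀ y, y ≠ x → ∃ i ≤ n, f i = y := by
    intro y hy
    have : y ∈ Set.univ \ {x} := ⟨trivial, hy⟩
    rw [fS] at this; exact this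
  have hinner : ∀ i, 0 < i → i < n → ¬ C.Adj (f i) x := by
    intro i h0 hn hadj
    obtain ⟨p, q, -, -, hpq⟩ := h1' (f i)
    have e1 := (hpq _).1 ((fadj i hn.le (i - 1) (by omega)).2 (by omega))
    have e2 := (hpq _).1 ((fadj i hn.le (i + 1) (by omega)).2 (by omega))
    have e3 := (hpq _).1 hadj
    have d1 := fx (i - 1) (by omega)
    have d2 := fx (i + 1) (by omega)
    have d3 : f (i - 1) ≠ f (i + 1) := fun h => by
      have := finj _ (by omega) _ (by omega) h; omega
    grind
  obtain ⟨p, q, hpq, hnadj, hx⟩ := h1' x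
  -- The two neighbours of `x` are the ends of the path; they are not adjacent, so `2 ≤ n`, whence
  -- length at least four.
  have hends : C.Adj x (f 0) ∧ C.Adj x (f n) ∧ 2 ≤ n := by
    obtain ⟨i, hi, rfl⟩ := fsurj p (fun h => by
      have := (hx p).2 (Or.inl rfl); rw [h] at this; exact C.irrefl this)
    obtain ⟨j, hj, rfl⟩ := fsurj q (fun h => by
      have := (hx q).2 (Or.inr rfl); rw [h] at this; exact C.irrefl this)
    have ai := (hx _).2 (Or.inl rfl)
    have aj := (hx _).2 (Or.inr rfl)
    have ni : i = 0 ∨ i = n := by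
      by_contra hcon; exact hinner i (by omega) (by omega) ai.symm
    have nj : j = 0 ∨ j = n := by
      by_contra hcon; exact hinner j (by omega) (by omega) aj.symm
    have hij : i ≠ j := fun h => hpq (by rw [h])
    have hn2 : ¬ (i + 1 = j ∨ j + 1 = i) := fun h => hnadj ((fadj i hi j hj).2 h)
    rcases ni with rfl | rfl <;> rcases nj with rfl | rfl
    · omega
    · exact ⟨ai, aj, by omega⟩
    · exact ⟨aj, ai, by omega⟩
    · omega
  obtain ⟨hx0, hxn, hn2⟩ := hends
  have hxadj : ∀ i ≤ n, (C.Adj x (f i) ↔ i = 0 ∨ i = n) := by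
    intro i hi
    constructor
    · intro h; by_contra hcon; exact hinner i (by omega) (by omega) h.symm
    · rintro (rfl | rfl) <;> assumption
  -- The vertex `x` takes the last label `n + 1` and closes the path to a cycle.
  let g : ZMod (n + 2) → W := fun i => if i.val ≤ n then f i.val else x
  have ginj : Function.Injective g := by
    intro i j h
    have hi := ZMod.val_lt i
    have hj := ZMod.val_lt j
    simp only [g] at h
    apply ZMod.val_injective
    split_ifs at h with hi' hj' hj'
    · exact finj _ hi' _ hj' h
    · exact absurd h (fx _ hi')
    · exact absurd h.symm (fx _ hj')
    · omega
  have gsurj : Function.Surjective g := by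
    intro y
    by_cases hy : y = x
    · refine ⟨((n + 1 : ℕ) : ZMod (n + 2)), ?_⟩
      simp only [g, ZMod.val_natCast_of_lt (show n + 1 < n + 2 by omega)]
      simp [hy]
    · obtain ⟨i, hi, rfl⟩ := fsurj y hy
      refine ⟨((i : ℕ) : ZMod (n + 2)), ?_⟩
      simp only [g, ZMod.val_natCast_of_lt (show i < n + 2 by omega)]
      simp [hi]
  have gadj : ∀ i j : ZMod (n + 2), C.Adj (g i) (g j) ↔
      (i.val + 1) % (n + 2) = j.val ∨ (j.val + 1) % (n + 2) = i.val := by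
    intro i j
    have hi := ZMod.val_lt i
    have hj := ZMod.val_lt j
    have e : ∀ k : ZMod (n + 2), (k.val + 1) % (n + 2) = if k.val ≤ n then k.val + 1 else 0 := by
      intro k
      have := ZMod.val_lt k
      split_ifs with h
      · exact Nat.mod_eq_of_lt (by omega)
      · rw [show k.val + 1 = n + 2 by omega, Nat.mod_self]
    rw [e, e]
    simp only [g]
    split_ifs with hi' hj' hj'
    · rw [fadj _ hi' _ hj']
    · rw [C.adj_comm, hxadj _ hi']; omega
    · rw [hxadj _ hj']; omega
    · simp; omega
  have gbij : Function.Bijective g := ⟨ginj, gsurj⟩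
  refine ⟨n + 2, by omega, (Equiv.ofBijective g gbij).symm, ?_⟩
  intro a b
  obtain ⟨i, rfl⟩ := gsurj a
  obtain ⟨j, rfl⟩ := gsurj b
  rw [Equiv.ofBijective_symm_apply_apply, Equiv.ofBijective_symm_apply_apply, gadj]
  have key : ∀ i j : ZMod (n + 2), (i.val + 1) % (n + 2) = j.val ↔ j - i = 1 := by
    intro i j
    rw [sub_eq_iff_eq_add, add_comm (1 : ZMod (n + 2)), ← (ZMod.val_injective (n + 2)).eq_iff,
      ZMod.val_add, ZMod.val_one'' (by omega), eq_comm]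
  rw [key, key, or_comm]

/-- A labelling of a cycle amounts to an isomorphism with the standard cyclic graph. -/
theorem isCycleLabel_of_iso {W : Type*} {C : SimpleGraph W} {n : ℕ} (hn : 2 ≤ n)
    (e : C ≃g cycleGraph n) :
    ∃ e' : W ≃ ZMod n, IsCycleLabel C e' ∧ ∀ x, (e' x).val = (e x : ℕ) := by
  obtain ⟨m, rfl⟩ := Nat.exists_eq_add_of_le' hn
  refine ⟨e.toEquiv, fun a b => ?_, fun x => rfl⟩
  rw [← e.map_adj_iff, cycleGraph_adj]
  rfl

theorem IsCycleLabel.exists_iso {W : Type*} {C : SimpleGraph W} {n : ℕ} (hn : 2 ≤ n)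
    {e : W ≃ ZMod n} (he : IsCycleLabel C e) :
    ∃ e' : C ≃g cycleGraph n, ∀ x, (e x).val = (e' x : ℕ) := by
  obtain ⟨m, rfl⟩ := Nat.exists_eq_add_of_le' hn
  refine ⟨⟨e, fun {a b} => ?_⟩, fun x => rfl⟩
  rw [he, cycleGraph_adj]
  rfl

/-! ### Antipodes and mirror images do not depend on the chosen labelling. -/

/-- Two labellings of a cycle differ by a rotation or a reflection. -/
theorem IsCycleLabel.exists_eq_add_mul {W : Type*} {C : SimpleGraph W} {n : ℕ} (hn : 3 ≤ n)
    {e e' : W ≃ ZMod n} (he : IsCycleLabel C e) (he' : IsCycleLabel C e') :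
    ∃ c d : ZMod n, (d = 1 ∨ d = -1) ∧ ∀ x, e' x = c + d * e x := by
  have : NeZero n := ⟨by omega⟩
  let s : ZMod n → ZMod n := fun k => e' (e.symm k)
  have hs : Function.Injective s := e'.injective.comp e.symm.injective
  have hstep : ∀ k, s (k + 1) - s k = 1 ∨ s (k + 1) - s k = -1 := by
    intro k
    have : C.Adj (e.symm (k + 1)) (e.symm k) := by rw [he]; simp
    rw [he'] at this
    refine this.imp id fun h => ?_
    rw [← neg_sub, h]
  have h2 : (2 : ZMod n) ≠ 0 := by
    intro h
    have : ((2 : ℕ) : ZMod n) = 0 := by exact_mod_cast h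
    rw [ZMod.natCast_eq_zero_iff] at this
    exact absurd (Nat.le_of_dvd (by norm_num) this) (by omega)
  -- Two successive steps of opposite sign would give `s (k + 2) = s k`, against injectivity because
  -- `2 ≠ 0`.
  have hk : ∀ k : ℕ, s (k + 1) - s k = s 1 - s 0 := by
    intro k
    induction k with
    | zero => simp
    | succ k ih =>
      rw [← ih]
      have hne : s ((k : ZMod n) + 1 + 1) ≠ s k := fun h => by
        have := hs h
        rw [add_assoc, add_eq_left, one_add_one_eq_two] at this
        exact h2 this
      push_cast
      have a1 := hstep k
      have a2 := hstep (k + 1)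
      rcases a1 with a1 | a1 <;> rcases a2 with a2 | a2
      · rw [a1, a2]
      · exact absurd (by linear_combination a1 + a2) hne
      · exact absurd (by linear_combination a1 + a2) hne
      · rw [a1, a2]
  have hlin : ∀ k : ℕ, s k = s 0 + (s 1 - s 0) * k := by
    intro k
    induction k with
    | zero => simp
    | succ k ih =>
      push_cast
      linear_combination hk k + ih
  refine ⟨s 0, s 1 - s 0, by simpa using hstep 0, fun x => ?_⟩
  have := hlin (e x).val
  rw [ZMod.natCast_zmod_val] at this
  simpa [s] using this

theorem antipodal_val_iff {n : ℕ} (hn : 1 ≤ n) (a b : ZMod (2 * n)) :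
    (b.val = a.val + n ∨ a.val = b.val + n) ↔ b = a + n := by
  have : NeZero (2 * n) := ⟨by omega⟩
  have ha := ZMod.val_lt a
  have hb := ZMod.val_lt b
  have key : b = a + n ↔ b.val = (a.val + n) % (2 * n) := by
    rw [← (ZMod.val_injective (2 * n)).eq_iff, ZMod.val_add, ZMod.val_natCast,
      Nat.mod_eq_of_lt (show n < 2 * n by omega)]
  rw [key]
  rcases lt_or_ge a.val n with h | h
  · rw [Nat.mod_eq_of_lt (by omega)]; omega
  · rw [Nat.mod_eq_sub_mod (by omega), Nat.mod_eq_of_lt (by omega)]; omega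

/-- In a labelled cycle the antipode is the translate by half of the length. -/
theorem IsCycleLabel.antipodal_iff {W : Type*} {C : SimpleGraph W} {n : ℕ} (hn : 2 ≤ n)
    {e : W ≃ ZMod (2 * n)} (he : IsCycleLabel C e) (x z : W) :
    AntipodalInCycle C x z ↔ e z = e x + n := by
  constructor
  · rintro ⟨m, e₀, h⟩
    have hcard : 2 * m = 2 * n := by
      have := Nat.card_congr (e₀.toEquiv.symm.trans e)
      simpa using this
    obtain rfl : m = n := by omega
    obtain ⟨e', he', hval⟩ := isCycleLabel_of_iso (by omega) e₀
    rw [← hval, ← hval, antipodal_val_iff (by omega)] at h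
    obtain ⟨c, d, hd, hcd⟩ := he'.exists_eq_add_mul (by omega) he
    rw [hcd, hcd, h]
    -- The half turn is its own negative, so reversing the orientation of the labelling does not
    -- affect it.
    have hm : (m : ZMod (2 * m)) = -m := by
      rw [eq_neg_iff_add_eq_zero, ← two_mul]; exact_mod_cast ZMod.natCast_self (2 * m)
    rcases hd with rfl | rfl
    · ring
    · linear_combination -hm
  · intro h
    obtain ⟨e', hval⟩ := he.exists_iso (by omega)
    refine ⟨n, e', ?_⟩
    rw [← hval, ← hval, antipodal_val_iff (by omega)]
    exact h

/-- Cutting out one vertex of a labelled cycle leaves a path. -/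
theorem exists_pathGraph_iso_of_ball {W : Type*} {P : SimpleGraph W} (h : IsGraphBall 1 P) :
    ∃ n, 3 ≤ n ∧ Nonempty (P ≃g pathGraph n) := by
  obtain ⟨H, hH, rfl⟩ := h
  obtain ⟨n, hn, e, he⟩ := exists_isCycleLabel hH
  obtain ⟨m, rfl⟩ : ∃ m, n = m + 1 := ⟨n - 1, by omega⟩
  -- Rotating the labels puts the removed vertex at `0`; the others get `1, ..., m`, lowered by one
  -- to land in `Fin m`.
  let t : Option W → ZMod (m + 1) := fun w => e w - e none
  have ht : Function.Bijective t :=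
    (Equiv.subRight (e none)).bijective.comp e.bijective
  have tadj : ∀ a b, H.Adj a b ↔ t a - t b = 1 ∨ t b - t a = 1 := by
    intro a b; rw [he]; simp [t]
  have t0 : t none = 0 := by simp [t]
  have tpos : ∀ w : W, 0 < (t (some w)).val := by
    intro w
    rw [Nat.pos_iff_ne_zero, Ne, ZMod.val_eq_zero, ← t0]
    intro h; simpa using ht.1 h
  have tlt : ∀ w, (t w).val < m + 1 := fun w => ZMod.val_lt _
  let f : W → Fin m := fun w => ⟨(t (some w)).val - 1, by have := tpos w; have := tlt (some w); omega⟩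
  have hf : Function.Bijective f := by
    constructor
    · intro a b h
      have := tpos a
      have := tpos b
      have h' : (t (some a)).val - 1 = (t (some b)).val - 1 := congrArg Fin.val h
      have := ht.1 (ZMod.val_injective _ (show (t (some a)).val = (t (some b)).val by omega))
      simpa using this
    · intro i
      have hi := i.2
      obtain ⟨w, hw⟩ := ht.2 ((i + 1 : ℕ) : ZMod (m + 1))
      have hval : (t w).val = i + 1 := by rw [hw, ZMod.val_natCast, Nat.mod_eq_of_lt (by omega)]
      cases w with
      | none => rw [t0] at hval; simp at hval
      | some w => exact ⟨w, by ext; simp [f, hval]⟩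
  refine ⟨m, by omega, ⟨Equiv.ofBijective f hf, fun {a b} => ?_⟩⟩
  have key : ∀ a b : W, t (some b) - t (some a) = 1 ↔ (t (some a)).val + 1 = (t (some b)).val := by
    intro a b
    have h1 := tpos b
    have h2 := tlt (some a)
    have h3 : 1 < m + 1 := by omega
    rw [sub_eq_iff_eq_add, add_comm (1 : ZMod (m + 1)), ← (ZMod.val_injective (m + 1)).eq_iff,
      ZMod.val_add, ZMod.val_one'' (by omega)]
    rcases (show (t (some a)).val + 1 < m + 1 ∨ (t (some a)).val + 1 = m + 1 by omega) with h | h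
    · rw [Nat.mod_eq_of_lt h, eq_comm]
    · rw [h, Nat.mod_self]
      have := tlt (some b)
      omega
  rw [comap_adj, tadj, key, key, or_comm, pathGraph_adj]
  have := tpos a
  have := tpos b
  simp only [Equiv.ofBijective_apply, f]
  omega

/-- An isomorphism of path graphs is the identity or the reflection. -/
theorem pathGraph_iso_rigid {n : ℕ} (s : pathGraph n ≃g pathGraph n) :
    (∀ i, s i = i) ∨ ∀ i, (s i : ℕ) + i + 1 = n := by
  rcases Nat.eq_zero_or_pos n with rfl | hn
  · exact .inl fun i => i.elim0
  have hadj : ∀ i j : Fin n, (i : ℕ) + 1 = j → (s i : ℕ) + 1 = s j ∨ (s j : ℕ) + 1 = s i := by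
    intro i j h
    rw [← pathGraph_adj, s.map_adj_iff, pathGraph_adj]
    exact .inl h
  have hinj : ∀ i j : Fin n, (s i : ℕ) = s j → (i : ℕ) = j := by
    intro i j h; rw [s.injective (Fin.ext h)]
  -- If the end `0` went to an inner vertex, it would need two distinct neighbours.
  have h0 : (s ⟨0, hn⟩ : ℕ) = 0 ∨ (s ⟨0, hn⟩ : ℕ) + 1 = n := by
    by_contra hcon
    have hlt := (s ⟨0, hn⟩).2
    obtain ⟨a, ha⟩ := s.surjective ⟨(s ⟨0, hn⟩ : ℕ) - 1, by omega⟩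
    obtain ⟨b, hb⟩ := s.surjective ⟨(s ⟨0, hn⟩ : ℕ) + 1, by omega⟩
    have ea : (pathGraph n).Adj ⟨0, hn⟩ a := by
      rw [← s.map_adj_iff, pathGraph_adj, ha]; simp; omega
    have eb : (pathGraph n).Adj ⟨0, hn⟩ b := by
      rw [← s.map_adj_iff, pathGraph_adj, hb]; simp
    rw [pathGraph_adj] at ea eb
    have hab : a = b := by ext; simp at ea eb; omega
    rw [hab, hb] at ha
    have := congrArg Fin.val ha
    simp at this; omega
  rcases h0 with h0 | h0
  · left
    -- The image of `k + 2` is adjacent to that of `k + 1` and differs from that of `k`, so it is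
    -- forced.
    have : ∀ k (hk : k < n), (s ⟨k, hk⟩ : ℕ) = k := by
      intro k
      induction k using Nat.strong_induction_on with
      | _ k ih =>
        intro hk
        rcases k with _ | _ | k
        · exact h0
        · have := hadj ⟨0, hn⟩ ⟨0 + 1, hk⟩ rfl
          omega
        · have a1 := ih k (by omega) (by omega)
          have a2 := ih (k + 1) (by omega) (by omega)
          have a3 := hadj ⟨k + 1, by omega⟩ ⟨k + 1 + 1, hk⟩ rfl
          have a4 := hinj ⟨k, by omega⟩ ⟨k + 1 + 1, hk⟩
          simp only at a4
          omega
    exact fun i => Fin.ext (this i i.2)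
  · right
    have : ∀ k (hk : k < n), (s ⟨k, hk⟩ : ℕ) + k + 1 = n := by
      intro k
      induction k using Nat.strong_induction_on with
      | _ k ih =>
        intro hk
        rcases k with _ | _ | k
        · exact h0
        · have := hadj ⟨0, hn⟩ ⟨0 + 1, hk⟩ rfl
          have := (s ⟨0 + 1, hk⟩).2
          omega
        · have a1 := ih k (by omega) (by omega)
          have a2 := ih (k + 1) (by omega) (by omega)
          have a3 := hadj ⟨k + 1, by omega⟩ ⟨k + 1 + 1, hk⟩ rfl
          have a4 := hinj ⟨k, by omega⟩ ⟨k + 1 + 1, hk⟩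
          simp only at a4
          omega
    exact fun i => this i i.2

/-- The mirror image in a path can be computed with any isomorphism to a path graph. -/
theorem mirrorInPath_iff {W : Type*} {P : SimpleGraph W} {n : ℕ} (e : P ≃g pathGraph n)
    (x z : W) : MirrorInPath P x z ↔ (e x : ℕ) + e z + 1 = n := by
  refine ⟨?_, fun h => ⟨n, e, h⟩⟩
  rintro ⟨m, e₀, h⟩
  obtain rfl : m = n := by
    have := Nat.card_congr (e₀.toEquiv.symm.trans e.toEquiv)
    simpa using this
  rcases pathGraph_iso_rigid (e₀.symm.trans e) with hs | hs
  · have h1 := hs (e₀ x)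
    have h2 := hs (e₀ z)
    simp at h1 h2
    rw [h1, h2]; exact h
  · have h1 := hs (e₀ x)
    have h2 := hs (e₀ z)
    simp at h1 h2
    omega

/-! ### Orbits of a permutation conjugated to its inverse. -/

theorem apply_pow_of_reverses {D : Type*} (φ : Equiv.Perm D) (r : D → D)
    (hφ : ∀ a, r (φ a) = φ⁻¹ (r a)) (i : ℕ) : ∀ a, r ((φ ^ i) a) = (φ ^ i)⁻¹ (r a) := by
  induction i with
  | zero => simp
  | succ i ih =>
    intro a
    rw [pow_succ, Equiv.Perm.mul_apply, ih, hφ, mul_inv_rev, ← Equiv.Perm.mul_apply,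
      (Commute.refl φ).inv_left.pow_right i |>.inv_right |>.eq]

/-- An orbit which is stable under a fixed point free map `r` reversing the permutation contains a
point at which `φ` and `r` agree. -/
theorem exists_reversed_of_sameCycle {D : Type*} [Finite D] (φ : Equiv.Perm D) (r : D → D)
    (hr : ∀ a, r a ≠ a) (hφ : ∀ a, r (φ a) = φ⁻¹ (r a)) {a : D} (ha : φ.SameCycle a (r a)) :
    ∃ b, φ.SameCycle a b ∧ φ b = r b := by
  have hpow := apply_pow_of_reverses φ r hφ
  obtain ⟨k, -, hk⟩ := ha.exists_pow_eq'
  -- Here `r a = φ ^ k a`. For `k = 2 * j` the point `φ ^ j a` would be fixed by `r`; for `k = 2 * j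
  -- + 1` it is the required point.
  obtain ⟨j, hj | hj⟩ := Nat.even_or_odd' k
  · refine absurd ?_ (hr ((φ ^ j) a))
    rw [hpow, ← hk, hj, two_mul, pow_add, Equiv.Perm.mul_apply, Equiv.Perm.inv_def, Equiv.symm_apply_apply]
  · refine ⟨(φ ^ j) a, ⟨j, by simp⟩, ?_⟩
    rw [hpow, ← hk, hj, two_mul, add_assoc, pow_add, Equiv.Perm.mul_apply,
      Equiv.Perm.inv_def, Equiv.symm_apply_apply, ← Equiv.Perm.mul_apply, ← pow_succ']

/-- On the cycle of `b`, `r` is the reflection `φ ^ i b ↦ φ ^ (1 - i) b`, so it agrees with `φ` at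
`φ ^ i b` exactly when the period divides `2 * i`. The period is even, as otherwise the reflection
would have a fixed point, so `i` is zero or half the period. -/
theorem ncard_reversed_sameCycle {D : Type*} [Finite D] (φ : Equiv.Perm D) (r : D → D)
    (hr : ∀ a, r a ≠ a) (hφ : ∀ a, r (φ a) = φ⁻¹ (r a)) {b : D} (hb : φ b = r b) :
    {a | φ.SameCycle b a ∧ φ a = r a}.ncard = 2 := by
  have hpow := apply_pow_of_reverses φ r hφ
  have hiff : ∀ i : ℕ, φ ((φ ^ i) b) = r ((φ ^ i) b) ↔ (φ ^ (2 * i)) b = b := by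
    intro i
    rw [hpow, ← hb, Equiv.Perm.eq_inv_iff_eq, ← Equiv.Perm.mul_apply, ← Equiv.Perm.mul_apply,
      mul_assoc, ← pow_succ', ← pow_add, show i + (i + 1) = 1 + 2 * i by ring, pow_add, pow_one,
      Equiv.Perm.mul_apply, φ.injective.eq_iff]
  set n := Function.minimalPeriod φ b with hn
  have hper : ∀ i : ℕ, (φ ^ i) b = b ↔ n ∣ i := by
    intro i
    rw [hn, ← Function.isPeriodicPt_iff_minimalPeriod_dvd, Function.IsPeriodicPt,
      Function.IsFixedPt, Equiv.Perm.iterate_eq_pow]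
  have hnpos : 0 < n := by
    refine Nat.pos_of_ne_zero fun h => ?_
    have := (hper (orderOf φ)).1 (by rw [pow_orderOf_eq_one]; rfl)
    rw [h, zero_dvd_iff] at this
    exact (orderOf_pos φ).ne' this
  have heven : Even n := by
    by_contra hodd
    obtain ⟨j, hj⟩ := Nat.not_even_iff_odd.1 hodd
    -- the point at half of the way round is fixed by `r`
    refine hr ((φ ^ (j + 1)) b) ?_
    rw [hpow, ← hb, Equiv.Perm.inv_eq_iff_eq, ← Equiv.Perm.mul_apply, ← pow_add,
      show j + 1 + (j + 1) = 1 + n by omega, pow_add, Equiv.Perm.mul_apply,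
      (hper n).2 dvd_rfl, pow_one]
  obtain ⟨m, hm⟩ := heven
  rw [Set.ncard_eq_two]
  refine ⟨b, (φ ^ m) b, fun h => ?_, ?_⟩
  · have := Nat.le_of_dvd (by omega) ((hper m).1 h.symm)
    omega
  · ext a
    simp only [Set.mem_ofPred_eq, Set.mem_insert_iff, Set.mem_singleton_iff]
    constructor
    · rintro ⟨hs, ha⟩
      obtain ⟨i, -, rfl⟩ := hs.exists_pow_eq'
      rw [hiff, hper, hm, ← two_mul, Nat.mul_dvd_mul_iff_left (by norm_num)] at ha
      obtain ⟨c, rfl⟩ := ha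
      obtain ⟨d, rfl | rfl⟩ := Nat.even_or_odd' c
      · left; rw [hper, hm]; exact ⟨d, by ring⟩
      · right
        rw [show m * (2 * d + 1) = m + n * d by rw [hm]; ring, pow_add, Equiv.Perm.mul_apply,
          (hper _).2 ⟨d, rfl⟩]
    · rintro (rfl | rfl)
      · exact ⟨.refl _ _, hb⟩
      · refine ⟨⟨m, by simp⟩, ?_⟩
        rw [hiff, hper, hm, two_mul]

/-- Twice the number of orbits stable under a fixed point free map `r` reversing the
permutation is the
number of the points which the permutation reverses. -/
theorem two_mul_ncard_reversed_orbits {D : Type*} [Finite D] (φ : Equiv.Perm D) (r : D → D)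
    (hr : ∀ a, r a ≠ a) (hφ : ∀ a, r (φ a) = φ⁻¹ (r a)) :
    2 * {O | (∃ a, O = {b | φ.SameCycle a b}) ∧ ∀ a ∈ O, r a ∈ O}.ncard =
      {a | φ a = r a}.ncard := by
  classical
  have := Fintype.ofFinite D
  set U : Set (Set D) := {O | (∃ a, O = {b | φ.SameCycle a b}) ∧ ∀ a ∈ O, r a ∈ O} with hU
  set F : Set D := {a | φ a = r a} with hF
  have hzpow : ∀ (i : ℤ) a, r ((φ ^ i) a) = (φ ^ (-i)) (r a) := by
    have hφ' : ∀ a, r (φ⁻¹ a) = φ (r a) := by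
      intro a
      have := hφ (φ⁻¹ a)
      rw [Equiv.Perm.inv_def, Equiv.apply_symm_apply, Equiv.eq_symm_apply] at this
      exact this.symm
    intro i
    induction i using Int.induction_on with
    | zero => simp
    | succ i ih =>
      intro a
      rw [zpow_add_one, Equiv.Perm.mul_apply, ih, hφ, ← Equiv.Perm.mul_apply, ← zpow_sub_one]
      congr 2; ring
    | pred i ih =>
      intro a
      rw [zpow_sub_one, Equiv.Perm.mul_apply, ih, hφ', ← Equiv.Perm.mul_apply, ← zpow_add_one]
      congr 2; ring
  have hsame : ∀ {a b}, φ.SameCycle a b → φ.SameCycle (r a) (r b) := by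
    rintro a _ ⟨i, rfl⟩
    exact ⟨-i, (hzpow i a).symm⟩
  let p : D → Set D := fun a => {b | φ.SameCycle a b}
  have hp : ∀ a b, φ.SameCycle a b ↔ p a = p b := by
    intro a b
    refine ⟨fun h => Set.ext fun c => ⟨fun hc => h.symm.trans hc, fun hc => h.trans hc⟩, fun h => ?_⟩
    have : b ∈ p a := by rw [h]; exact .refl _ _
    exact this
  have hmaps : ∀ a ∈ F.toFinset, p a ∈ U.toFinset := by
    intro a ha
    rw [Set.mem_toFinset] at ha ⊢
    refine ⟨⟨a, rfl⟩, fun b hb => ?_⟩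
    have h1 : φ.SameCycle (r a) (r b) := hsame hb
    have h2 : φ.SameCycle a (r a) := by rw [← show φ a = r a from ha]; exact ⟨1, by simp⟩
    exact h2.trans h1
  -- The reversed points are counted by their orbits: every fibre of `p` over a stable orbit has two
  -- elements.
  rw [Set.ncard_eq_toFinset_card', Set.ncard_eq_toFinset_card',
    Finset.card_eq_sum_card_fiberwise hmaps, Finset.sum_const_nat (m := 2), mul_comm]
  intro O hO
  rw [Set.mem_toFinset] at hO
  obtain ⟨⟨a, rfl⟩, hO⟩ := hO
  obtain ⟨b, hab, hb⟩ := exists_reversed_of_sameCycle φ r hr hφ (hO a (Equiv.Perm.SameCycle.refl _ _))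
  rw [← ncard_reversed_sameCycle φ r hr hφ hb, Set.ncard_eq_toFinset_card']
  congr 1
  ext c
  simp only [Finset.mem_filter, Set.mem_toFinset, Set.mem_ofPred_eq, hF]
  rw [and_comm, hp b c]
  refine and_congr_left fun _ => ?_
  have h1 : p a = p b := (hp _ _).1 hab
  change p c = p a ↔ _
  rw [h1, eq_comm]

/-! ### Vanishing of mod 2 homology for contractible graphs and 2-spheres. -/

section Chains

variable {W : Type*} [Fintype W] [DecidableEq W]

/-- A one-chain modulo two of the subgraph generated by `S`. -/
def IsEdgeChain (G : SimpleGraph W) (S : Set W) (c : W → W → ZMod 2) : Prop :=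
  (∀ u v, c u v = c v u) ∧ ∀ u v, c u v ≠ 0 → G.Adj u v ∧ u ∈ S ∧ v ∈ S

/-- A two-chain modulo two of the clique complex of the subgraph generated by `S`. -/
def IsTriangleChain (G : SimpleGraph W) (S : Set W) (β : W → W → W → ZMod 2) : Prop :=
  (∀ u v w, β u v w = β v u w) ∧ (∀ u v w, β u v w = β u w v) ∧
    ∀ u v w, β u v w ≠ 0 → (G.Adj u v ∧ G.Adj v w ∧ G.Adj u w) ∧ u ∈ S ∧ v ∈ S ∧ w ∈ S

/-- The reduced homology modulo two in degree zero vanishes. -/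
def AcyclicZero (G : SimpleGraph W) (S : Set W) : Prop :=
  ∀ f : W → ZMod 2, (∀ u, f u ≠ 0 → u ∈ S) → ∑ u, f u = 0 →
    ∃ p, IsEdgeChain G S p ∧ ∀ v, ∑ u, p v u = f v

/-- The homology modulo two in degree one vanishes. -/
def AcyclicOne (G : SimpleGraph W) (S : Set W) : Prop :=
  ∀ c, IsEdgeChain G S c → (∀ v, ∑ u, c v u = 0) →
    ∃ β, IsTriangleChain G S β ∧ ∀ u v, ∑ w, β u v w = c u v

/-- The coefficient at `x` is pushed along one edge to a neighbour `l`, leaving a chain of sum zero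
off `x`. -/
theorem AcyclicZero.of_link {G : SimpleGraph W} {S : Set W} {x : W} (hx : x ∈ S)
    (hl : (S ∩ G.neighborSet x).Nonempty) (h : AcyclicZero G (S \ {x})) : AcyclicZero G S := by
  obtain ⟨l, hlS, hxl⟩ := hl
  have hxl : G.Adj x l := hxl
  have hne : x ≠ l := hxl.ne
  intro f hf hsum
  let δ : W → W → ZMod 2 := fun a b => if b = a then 1 else 0
  have hδ : ∀ a, ∑ b, δ a b = 1 := by intro a; simp [δ]
  obtain ⟨p, ⟨hps, hpS⟩, hp⟩ := h (fun u => f u + f x * (δ x u + δ l u)) (by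
    intro u hu
    by_cases hux : u = x
    · subst hux
      refine absurd ?_ hu
      simp only [δ, if_true, if_neg hne]
      rw [add_zero, mul_one, CharTwo.add_self_eq_zero]
    · refine ⟨?_, hux⟩
      by_cases hul : u = l
      · rw [hul]; exact hlS
      · refine hf u fun h0 => hu ?_
        simp [δ, hux, hul, h0]) (by
    rw [Finset.sum_add_distrib, hsum, ← Finset.mul_sum, Finset.sum_add_distrib, hδ, hδ,
      CharTwo.add_self_eq_zero, mul_zero, add_zero])
  refine ⟨fun u v => p u v + f x * (δ x u * δ l v + δ l u * δ x v), ⟨?_, ?_⟩, ?_⟩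
  · intro u v
    beta_reduce
    rw [hps u v]; ring
  · intro u v huv
    beta_reduce at huv
    by_cases hpuv : p u v = 0
    · by_cases h1 : u = x ∧ v = l
      · rw [h1.1, h1.2]; exact ⟨hxl, hx, hlS⟩
      by_cases h2 : u = l ∧ v = x
      · rw [h2.1, h2.2]; exact ⟨hxl.symm, hlS, hx⟩
      refine absurd ?_ huv
      rw [hpuv]
      simp only [δ, ← ite_and, mul_ite, mul_one, mul_zero]
      rw [if_neg (by tauto), if_neg (by tauto)]
      simp
    · obtain ⟨a, b, c⟩ := hpS u v hpuv
      exact ⟨a, b.1, c.1⟩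
  · intro v
    rw [Finset.sum_add_distrib, hp, ← Finset.mul_sum, Finset.sum_add_distrib, ← Finset.mul_sum,
      ← Finset.mul_sum, hδ, hδ, mul_one, mul_one, add_assoc, CharTwo.add_self_eq_zero, add_zero]

theorem ContractibleOn.acyclicZero {G : SimpleGraph W} {S : Set W} (h : ContractibleOn G S) :
    AcyclicZero G S := by
  induction h with
  | point x =>
    intro f hf hsum
    have hf0 : ∀ u, f u = 0 := by
      intro u
      by_cases hux : u = x
      · rw [hux]
        rw [Finset.sum_eq_single x (fun b _ hb => by by_contra h0; exact hb (hf b h0))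
          (by simp)] at hsum
        exact hsum
      · by_contra h0; exact hux (hf u h0)
    exact ⟨fun _ _ => 0, ⟨fun _ _ => rfl, fun _ _ h => absurd rfl h⟩, fun v => by simp [hf0]⟩
  | step S x hx hdel hsph ih1 ih2 => exact ih1.of_link hx hsph.nonempty

/-- The edges of a cycle `c` at `x` define a zero-chain of sum zero on the link, bounded there by
some `p`. Adding the boundary of the cone `γ` from `x` over `p` moves `c` off `x`. -/
theorem AcyclicOne.of_link {G : SimpleGraph W} {S : Set W} {x : W} (hx : x ∈ S)
    (hl : AcyclicZero G (S ∩ G.neighborSet x)) (h : AcyclicOne G (S \ {x})) :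
    AcyclicOne G S := by
  rintro c ⟨hcs, hcS⟩ hc
  obtain ⟨p, ⟨hps, hpS⟩, hp⟩ := hl (c x)
    (fun u hu => ⟨(hcS x u hu).2.2, (hcS x u hu).1⟩) (hc x)
  let δ : W → ZMod 2 := fun b => if b = x then 1 else 0
  have hδ : ∑ b, δ b = 1 := by simp [δ]
  have hδ1 : ∀ {b}, δ b ≠ 0 → b = x := by
    intro b hb; by_contra h; exact hb (by simp [δ, h])
  have hpx : ∀ v, p x v = 0 := by
    intro v; by_contra h0
    exact G.irrefl (hpS x v h0).2.1.2
  have hcx : c x x = 0 := by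
    by_contra h0; exact G.irrefl (hcS x x h0).1
  let γ : W → W → W → ZMod 2 := fun u v w => δ u * p v w + δ v * p u w + δ w * p u v
  have hγ : ∀ u v, ∑ w, γ u v w = δ u * c x v + δ v * c x u + p u v := by
    intro u v
    simp only [γ]
    rw [Finset.sum_add_distrib, Finset.sum_add_distrib, ← Finset.mul_sum, ← Finset.mul_sum,
      ← Finset.sum_mul, hp, hp, hδ, one_mul]
  have hcone : ∀ {u v w}, δ u * p v w ≠ 0 →
      (G.Adj u v ∧ G.Adj v w ∧ G.Adj u w) ∧ u ∈ S ∧ v ∈ S ∧ w ∈ S := by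
    intro u v w h0
    obtain ⟨h1, h2⟩ := ne_zero_and_ne_zero_of_mul h0
    obtain rfl := hδ1 h1
    obtain ⟨a, b, c⟩ := hpS v w h2
    exact ⟨⟨b.2, a, c.2⟩, hx, b.1, c.1⟩
  obtain ⟨β, ⟨hβ1, hβ2, hβS⟩, hβ⟩ := h (fun u v => c u v + ∑ w, γ u v w) ⟨by
    intro u v
    beta_reduce
    rw [hγ, hγ, hcs u v, hps u v]; ring, by
    have hzero : ∀ v, c x v + ∑ w, γ x v w = 0 := by
      intro v
      rw [hγ, hpx, hcx]
      simp [δ, CharTwo.add_self_eq_zero]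
    have hsymm : ∀ u v, c u v + ∑ w, γ u v w = c v u + ∑ w, γ v u w := by
      intro u v
      rw [hγ, hγ, hcs u v, hps u v]; ring
    intro u v huv
    beta_reduce at huv
    have hu : u ≠ x := by rintro rfl; exact huv (hzero v)
    have hv : v ≠ x := by rintro rfl; exact huv (by rw [hsymm]; exact hzero u)
    rw [hγ] at huv
    simp only [δ, if_neg hu, if_neg hv, zero_mul, zero_add] at huv
    by_cases hcuv : c u v = 0
    · rw [hcuv, zero_add] at huv
      obtain ⟨a, b, d⟩ := hpS u v huv
      exact ⟨a, ⟨b.1, hu⟩, ⟨d.1, hv⟩⟩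
    · obtain ⟨a, b, d⟩ := hcS u v hcuv
      exact ⟨a, ⟨b, hu⟩, ⟨d, hv⟩⟩⟩ (by
    intro v
    simp only [hγ]
    rw [Finset.sum_add_distrib, hc, Finset.sum_add_distrib, Finset.sum_add_distrib,
      ← Finset.mul_sum, hc, ← Finset.sum_mul, hδ, hp, mul_zero, one_mul, zero_add, zero_add,
      CharTwo.add_self_eq_zero])
  refine ⟨fun u v w => β u v w + γ u v w, ⟨?_, ?_, ?_⟩, ?_⟩
  · intro u v w
    simp only [γ]
    rw [hβ1 u v w, hps u v]; ring
  · intro u v w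
    simp only [γ]
    rw [hβ2 u v w, hps v w]; ring
  · intro u v w h0
    beta_reduce at h0
    by_cases hb : β u v w = 0
    · rw [hb, zero_add] at h0
      by_cases h1 : δ u * p v w = 0
      · by_cases h2 : δ v * p u w = 0
        · simp only [γ, h1, h2, zero_add] at h0
          obtain ⟨⟨a, b, c⟩, d, e, f⟩ := hcone h0
          exact ⟨⟨b, c.symm, a.symm⟩, e, f, d⟩
        · obtain ⟨⟨a, b, c⟩, d, e, f⟩ := hcone h2
          exact ⟨⟨a.symm, c, b⟩, e, d, f⟩
      · exact hcone h1
    · obtain ⟨a, b, c, d⟩ := hβS u v w hb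
      exact ⟨a, b.1, c.1, d.1⟩
  · intro u v
    rw [Finset.sum_add_distrib, hβ, add_assoc, CharTwo.add_self_eq_zero, add_zero]

theorem ContractibleOn.acyclicOne {G : SimpleGraph W} {S : Set W} (h : ContractibleOn G S) :
    AcyclicOne G S := by
  induction h with
  | point x =>
    rintro c ⟨-, hcS⟩ -
    refine ⟨fun _ _ _ => 0, ⟨fun _ _ _ => rfl, fun _ _ _ => rfl, fun _ _ _ h => absurd rfl h⟩,
      fun u v => ?_⟩
    rw [Finset.sum_const_zero, eq_comm]
    by_contra h0
    obtain ⟨hadj, hu, hv⟩ := hcS u v h0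
    rw [Set.mem_singleton_iff] at hu hv
    rw [hu, hv] at hadj
    exact G.irrefl hadj
  | step S x hx hdel hsph ih1 ih2 => exact ih1.of_link hx hsph.acyclicZero

/-- A two-dimensional sphere has no homology modulo two in degree one. -/
theorem IsGraphSphere.acyclicOne {G : SimpleGraph W} (h : IsGraphSphere 2 G) :
    AcyclicOne G Set.univ := by
  obtain ⟨h1, x, hx, h2⟩ := h
  refine h2.acyclicOne.of_link hx ?_
  obtain ⟨h3, y, hy, h4⟩ := h1 x hx
  obtain ⟨a, b, -, -, hab⟩ := (h3 y hy).exists_pair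
  -- The link of `x` is a 1-sphere: removing `y` leaves it contractible, and `y` has neighbours in
  -- it.
  exact h4.acyclicZero.of_link hy (by rw [hab]; exact ⟨a, .inl rfl⟩)

end Chains

/-- A set of ordered triples closed under rotation, without constant triples, has a cardinality
divisible by three. -/
theorem three_dvd_card_of_rotation {W : Type*} (T : Finset (W × W × W))
    (hrot : ∀ u v w, (u, v, w) ∈ T → (v, w, u) ∈ T)
    (hne : ∀ u v w, (u, v, w) ∈ T → u ≠ v) : 3 ∣ T.card := by
  classical
  -- A fixed point of the rotation, whose cube is the identity, would be a constant triple; so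
  -- `T.card` is zero modulo three.
  let f : Function.End T := fun t => ⟨(t.1.2.1, t.1.2.2, t.1.1), hrot _ _ _ t.2⟩
  have hf : f ^ 3 ^ 1 = 1 := rfl
  have : Fact (Nat.Prime 3) := ⟨Nat.prime_three⟩
  have h := Equiv.Perm.card_fixedPoints_modEq (α := T) hf
  have hempty : Fintype.card (Function.fixedPoints f) = 0 := by
    rw [Fintype.card_eq_zero_iff]
    refine ⟨fun ⟨t, ht⟩ => hne t.1.1 t.1.2.1 t.1.2.2 t.2 ?_⟩
    exact (congrArg (fun s : T => s.1.1) ht).symm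
  rw [hempty, Fintype.card_coe] at h
  exact (Nat.modEq_zero_iff_dvd).1 h

/-! ### Counting triangles in a 2-sphere modulo three. -/

section Sphere

/-- Any two adjacent vertices of a two-dimensional sphere have exactly two common neighbours. -/
theorem IsGraphSphere.exists_common_neighbors {W : Type*} {H : SimpleGraph W}
    (h : IsGraphSphere 2 H) {u v : W} (huv : H.Adj u v) :
    ∃ a b, a ≠ b ∧ ∀ w, H.Adj u w ∧ H.Adj v w ↔ w = a ∨ w = b := by
  have h1 := (h.1 u trivial).1 v ⟨trivial, huv⟩
  obtain ⟨a, b, hab, -, hS⟩ := SphereOn.exists_pair h1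
  exact ⟨a, b, hab, fun w => by simpa using Set.ext_iff.1 hS w⟩

/-- A function on the directed edges of a unit sphere in a two-dimensional sphere, which is symmetric
and takes the same value on both edges at each vertex, is constant. -/
theorem IsGraphSphere.exists_const_of_link {W : Type*} {H : SimpleGraph W} (h : IsGraphSphere 2 H)
    (o : W) {R : Type*} (g : W → W → R) (hs : ∀ u v, g u v = g v u)
    (hg : ∀ u a b, H.Adj o u → H.Adj o a → H.Adj o b → H.Adj u a → H.Adj u b → g u a = g u b) :
    ∃ k, ∀ u v, H.Adj o u → H.Adj o v → H.Adj u v → g u v = k := by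
  have hsph : IsGraphSphere 1 (unitSphere H o) := by
    refine SphereOn.of_image Subtype.val_injective (S := Set.univ) ?_
    have := h.1 o trivial
    rwa [Set.univ_inter, ← Subtype.range_coe (s := H.neighborSet o), ← Set.image_univ] at this
  obtain ⟨n, hn, e, he⟩ := exists_isCycleLabel hsph
  have : NeZero n := ⟨by omega⟩
  let t : ZMod n → W := fun k => e.symm k
  have hto : ∀ k, H.Adj o (t k) := fun k => (e.symm k).2
  have htt : ∀ k, H.Adj (t k) (t (k + 1)) := by
    intro k
    have : (unitSphere H o).Adj (e.symm k) (e.symm (k + 1)) := by rw [he]; simp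
    exact this
  -- Successive edges of the link cycle share the vertex `t (k + 1)`, so the value propagates all
  -- the way round.
  have hstep : ∀ k, g (t (k + 1)) (t (k + 1 + 1)) = g (t k) (t (k + 1)) := by
    intro k
    rw [hs (t k)]
    exact hg _ _ _ (hto _) (hto _) (hto _) (htt _) (htt _).symm
  have hconst : ∀ k : ℕ, g (t k) (t (k + 1)) = g (t 0) (t (0 + 1)) := by
    intro k
    induction k with
    | zero => simp
    | succ k ih => push_cast; exact (hstep k).trans ih
  have hconst' : ∀ k, g (t k) (t (k + 1)) = g (t 0) (t (0 + 1)) := by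
    intro k
    have := hconst k.val
    rwa [ZMod.natCast_zmod_val] at this
  refine ⟨g (t 0) (t (0 + 1)), fun u v hu hv huv => ?_⟩
  have hadj : (unitSphere H o).Adj ⟨u, hu⟩ ⟨v, hv⟩ := huv
  have tu : t (e ⟨u, hu⟩) = u := by simp [t]
  have tv : t (e ⟨v, hv⟩) = v := by simp [t]
  rw [he] at hadj
  rcases hadj with hadj | hadj
  · rw [hs, ← hconst' (e ⟨v, hv⟩), ← hadj, add_sub_cancel, tu, tv]
  · rw [← hconst' (e ⟨u, hu⟩), ← hadj, add_sub_cancel, tu, tv]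

theorem card_filter_triple {W : Type*} [Fintype W] (P : W → W → W → Prop) [∀ u v w, Decidable (P u v w)] :
    (Finset.univ.filter fun t : W × W × W => P t.1 t.2.1 t.2.2).card =
      ∑ u, ∑ v, (Finset.univ.filter fun w => P u v w).card := by
  rw [Finset.card_filter, Fintype.sum_prod_type]
  simp only [Fintype.sum_prod_type, Finset.card_filter]

variable {W : Type*} [Fintype W] [DecidableEq W]

/-- A one-cycle modulo two of a two-dimensional sphere which avoids the vertex `o` bounds a
two-chain which avoids `o`. -/
theorem IsGraphSphere.exists_boundary_avoiding {H : SimpleGraph W} [DecidableRel H.Adj]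
    (h : IsGraphSphere 2 H) (o : W) {c : W → W → ZMod 2} (hc : IsEdgeChain H Set.univ c)
    (hsum : ∀ v, ∑ u, c v u = 0) (ho : ∀ u, c o u = 0) :
    ∃ β, IsTriangleChain H Set.univ β ∧ (∀ u v, ∑ w, β u v w = c u v) ∧ ∀ u v, β o u v = 0 := by
  obtain ⟨β, ⟨hβ1, hβ2, hβS⟩, hβ⟩ := h.acyclicOne c hc hsum
  have hadj : ∀ {u v w}, β u v w ≠ 0 → H.Adj u v ∧ H.Adj v w ∧ H.Adj u w :=
    fun h0 => (hβS _ _ _ h0).1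
  -- Each edge at `o` lies in just two triangles and has coefficient zero in `c`, so `β` agrees on
  -- both; hence `β` is constant on the triangles around `o`.
  obtain ⟨k, hk⟩ := h.exists_const_of_link o (β o) (hβ2 o) (by
    intro u a b hu ha hb hua hub
    by_cases hab : a = b
    · rw [hab]
    obtain ⟨p, q, hpq, hpqw⟩ := h.exists_common_neighbors hu
    have hsum2 : ∑ w, β o u w = β o u p + β o u q := by
      rw [← Finset.sum_pair hpq]
      refine (Finset.sum_subset (Finset.subset_univ _) fun w _ hw => ?_).symm
      by_contra h0
      obtain ⟨-, h1, h2⟩ := hadj h0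
      have := (hpqw w).1 ⟨h2, h1⟩
      simp only [Finset.mem_insert, Finset.mem_singleton] at hw
      exact hw this
    rw [hβ, ho] at hsum2
    have heq : β o u p = β o u q := (CharTwo.add_eq_zero.1 hsum2.symm)
    rcases (hpqw a).1 ⟨ha, hua⟩ with rfl | rfl <;> rcases (hpqw b).1 ⟨hb, hub⟩ with rfl | rfl
    · rfl
    · exact heq
    · exact heq.symm
    · rfl)
  have ho0 : ∀ u v, ¬ (H.Adj o u ∧ H.Adj u v ∧ H.Adj o v) → β o u v = 0 := by
    intro u v huv; by_contra h0; exact huv (hadj h0)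
  have hk' : k = 0 ∨ k = 1 := (by decide : ∀ k : ZMod 2, k = 0 ∨ k = 1) k
  rcases hk' with rfl | rfl
  · refine ⟨β, ⟨hβ1, hβ2, hβS⟩, hβ, fun u v => ?_⟩
    by_cases huv : H.Adj o u ∧ H.Adj u v ∧ H.Adj o v
    · exact hk u v huv.1 huv.2.2 huv.2.1
    · exact ho0 u v huv
  -- If the constant is one, adding the fundamental class `τ`, the sum of all triangles, clears `o`
  -- and keeps the boundary.
  · let τ : W → W → W → ZMod 2 := fun u v w => if H.Adj u v ∧ H.Adj v w ∧ H.Adj u w then 1 else 0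
    have hτ : ∀ u v, ∑ w, τ u v w = 0 := by
      intro u v
      by_cases huv : H.Adj u v
      · obtain ⟨p, q, hpq, hpqw⟩ := h.exists_common_neighbors huv
        have : ∀ w, τ u v w = if w ∈ ({p, q} : Finset W) then 1 else 0 := by
          intro w
          simp only [τ, Finset.mem_insert, Finset.mem_singleton, ← hpqw w, huv, true_and, and_comm]
        simp only [this]
        rw [Finset.sum_ite_mem, Finset.univ_inter, Finset.sum_pair hpq]
        rfl
      · simp [τ, huv]
    refine ⟨fun u v w => β u v w + τ u v w, ⟨?_, ?_, ?_⟩, ?_, ?_⟩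
    · intro u v w
      beta_reduce
      rw [hβ1 u v w]
      congr 1
      simp only [τ, H.adj_comm u v]
      congr 1
      exact propext (by tauto)
    · intro u v w
      beta_reduce
      rw [hβ2 u v w]
      congr 1
      simp only [τ, H.adj_comm v w]
      congr 1
      exact propext (by tauto)
    · intro u v w h0
      refine ⟨?_, trivial, trivial, trivial⟩
      by_contra hcon
      have h1 : β u v w = 0 := by by_contra h1; exact hcon (hadj h1)
      exact h0 (by simp only [h1, τ, if_neg hcon, add_zero])
    · intro u v
      rw [Finset.sum_add_distrib, hβ, hτ, add_zero]
    · intro u v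
      by_cases huv : H.Adj o u ∧ H.Adj u v ∧ H.Adj o v
      · simp only [τ, if_pos huv, hk u v huv.1 huv.2.2 huv.2.1]; rfl
      · simp only [τ, if_neg huv, ho0 u v huv, add_zero]

/-- If in a two-dimensional sphere every vertex other than `o` has an even number of neighbours
other than `o`, then the degree of `o` is divisible by three. -/
theorem IsGraphSphere.three_dvd_card_neighbors {H : SimpleGraph W} [DecidableRel H.Adj]
    (h : IsGraphSphere 2 H) (o : W)
    (heven : ∀ v, v ≠ o → Even (Finset.univ.filter fun u => H.Adj v u ∧ u ≠ o).card) :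
    3 ∣ (Finset.univ.filter fun u => H.Adj o u).card := by
  let Q : W → W → Prop := fun u v => H.Adj u v ∧ u ≠ o ∧ v ≠ o
  -- The sum of all edges off `o`; the parity hypothesis says that it is a cycle.
  let c : W → W → ZMod 2 := fun u v => if Q u v then 1 else 0
  obtain ⟨β, ⟨hβ1, hβ2, hβS⟩, hβ, hβo⟩ := h.exists_boundary_avoiding o (c := c)
    ⟨fun u v => by simp only [c, Q, H.adj_comm u v, and_comm (a := u ≠ o)], fun u v huv => by
      refine ⟨?_, trivial, trivial⟩
      by_contra hcon
      exact huv (by simp [c, Q, hcon])⟩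
    (fun v => by
      by_cases hv : v = o
      · simp [c, Q, hv]
      · simp only [c, Q, hv, ne_eq, not_false_eq_true, true_and]
        rw [Finset.sum_boole]
        exact (ZMod.natCast_eq_zero_iff_even).2 (heven v hv))
    (fun u => by simp [c, Q])
  have hadj : ∀ {u v w}, β u v w ≠ 0 → H.Adj u v ∧ H.Adj v w ∧ H.Adj u w :=
    fun h0 => (hβS _ _ _ h0).1
  -- each edge off `o` lies in exactly one triangle of `β`
  have hfib : ∀ u v, (Finset.univ.filter fun w => β u v w ≠ 0).card = if Q u v then 1 else 0 := by
    intro u v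
    by_cases huv : Q u v
    · rw [if_pos huv]
      have hcuv : c u v = 1 := if_pos huv
      obtain ⟨p, q, hpq, hpqw⟩ := h.exists_common_neighbors huv.1
      have hsub : (Finset.univ.filter fun w => β u v w ≠ 0) ⊆ {p, q} := by
        intro w hw
        rw [Finset.mem_filter] at hw
        obtain ⟨-, h1, h2⟩ := hadj hw.2
        simpa using (hpqw w).1 ⟨h2, h1⟩
      have hle := (Finset.card_le_card hsub).trans (Finset.card_le_two)
      have hone : ∀ z : ZMod 2, z = if z ≠ 0 then 1 else 0 := by decide
      have hodd : (((Finset.univ.filter fun w => β u v w ≠ 0).card : ℕ) : ZMod 2) = 1 := by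
        rw [← Finset.sum_boole]
        refine Eq.trans ?_ ((hβ u v).trans hcuv)
        exact Finset.sum_congr rfl fun w _ => (hone _).symm
      rw [ZMod.natCast_eq_one_iff_odd] at hodd
      obtain ⟨j, hj⟩ := hodd
      omega
    · rw [if_neg huv, Finset.card_eq_zero, Finset.filter_eq_empty_iff]
      intro w _ h0
      have hu : u ≠ o := by rintro rfl; exact h0 (hβo _ _)
      have hv : v ≠ o := by rintro rfl; exact h0 (by rw [hβ1]; exact hβo _ _)
      exact huv ⟨(hadj h0).1, hu, hv⟩
  have hfibT : ∀ u v, (Finset.univ.filter fun w => H.Adj u v ∧ H.Adj v w ∧ H.Adj u w).card =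
      2 * if H.Adj u v then 1 else 0 := by
    intro u v
    by_cases huv : H.Adj u v
    · obtain ⟨p, q, hpq, hpqw⟩ := h.exists_common_neighbors huv
      rw [if_pos huv, mul_one, ← Finset.card_pair hpq]
      congr 1
      ext w
      simp only [Finset.mem_filter, Finset.mem_univ, true_and, Finset.mem_insert,
        Finset.mem_singleton, ← hpqw w, huv]
      tauto
    · simp [huv]
  have h3β : 3 ∣ ∑ u, ∑ v, (if Q u v then 1 else 0 : ℕ) := by
    simp only [← hfib]
    rw [← card_filter_triple]
    refine three_dvd_card_of_rotation _ (fun u v w ht => ?_) (fun u v w ht => ?_)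
    · simp only [Finset.mem_filter, Finset.mem_univ, true_and] at ht ⊢
      rwa [hβ2, hβ1]
    · simp only [Finset.mem_filter, Finset.mem_univ, true_and] at ht
      exact (hadj ht).1.ne
  have h3T : 3 ∣ 2 * ∑ u, ∑ v, (if H.Adj u v then 1 else 0 : ℕ) := by
    simp only [Finset.mul_sum, ← hfibT]
    rw [← card_filter_triple]
    refine three_dvd_card_of_rotation _ (fun u v w ht => ?_) (fun u v w ht => ?_)
    · simp only [Finset.mem_filter, Finset.mem_univ, true_and] at ht ⊢
      exact ⟨ht.2.1, ht.2.2.symm, ht.1.symm⟩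
    · simp only [Finset.mem_filter, Finset.mem_univ, true_and] at ht
      exact ht.1.ne
  have hsplit : ∑ u, ∑ v, (if H.Adj u v then 1 else 0 : ℕ) =
      (∑ u, ∑ v, (if Q u v then 1 else 0 : ℕ)) +
        2 * (Finset.univ.filter fun u => H.Adj o u).card := by
    have hpt : ∀ u v, (if H.Adj u v then 1 else 0 : ℕ) = (if Q u v then 1 else 0) +
        ((if u = o then (if H.Adj o v then 1 else 0) else 0) +
          if v = o then (if H.Adj o u then 1 else 0) else 0) := by
      intro u v
      by_cases hu : u = o <;> by_cases hv : v = o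
      · simp [Q, hu, hv]
      · simp [Q, hu, hv]
      · simp [Q, hu, hv, H.adj_comm u o]
      · simp [Q, hu, hv]
    rw [Finset.sum_congr rfl fun u _ => Finset.sum_congr rfl fun v _ => hpt u v]
    simp only [Finset.sum_add_distrib]
    congr 1
    rw [two_mul, Finset.card_filter]
    congr 1
    · rw [Finset.sum_comm]; simp
    · simp
  -- With directed edges, 3 divides the number off `o` and twice the total; these counts differ by
  -- `2 * deg o`, so 3 divides `4 * deg o`.
  omega

end Sphere

/-! ### Two-balls seen inside the sphere with one more vertex. -/

section Ball

variable {V : Type*} {H : SimpleGraph (Option V)}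

theorem IsGraphSphere.mem_interiorVertices (h : IsGraphSphere 2 H) {y : V}
    (hy : ¬ H.Adj none (some y)) : y ∈ interiorVertices (H.comap some) := by
  have hinj : Function.Injective fun z : (H.comap some).neighborSet y => some z.1 :=
    (Option.some_injective V).comp Subtype.val_injective
  refine SphereOn.of_image hinj (S := Set.univ) ?_
  convert h.1 (some y) trivial using 1
  ext w
  simp only [Set.image_univ, Set.mem_range, Set.mem_inter_iff, Set.mem_univ, true_and]
  constructor
  · rintro ⟨z, rfl⟩; exact z.2
  · intro hw
    cases w with
    | none => exact absurd (H.adj_symm hw) hy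
    | some w => exact ⟨⟨w, hw⟩, rfl⟩

/-- The unit sphere of `y` in `H` is a cycle through `none`; deleting `none` from it leaves the unit
sphere of `y` in the ball. -/
theorem IsGraphSphere.mem_boundaryVertices (h : IsGraphSphere 2 H) {y : V}
    (hy : H.Adj none (some y)) : y ∈ boundaryVertices (H.comap some) := by
  let f : Option ((H.comap some).neighborSet y) → Option V := Option.map Subtype.val
  have hinj : Function.Injective f := Option.map_injective Subtype.val_injective
  refine ⟨H.comap f, SphereOn.of_image hinj (S := Set.univ) ?_, rfl⟩
  convert h.1 (some y) trivial using 1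
  ext w
  simp only [Set.image_univ, Set.mem_range, Set.mem_inter_iff, Set.mem_univ, true_and]
  constructor
  · rintro ⟨z, rfl⟩
    cases z with
    | none => exact hy.symm
    | some z => exact z.2
  · intro hw
    cases w with
    | none => exact ⟨none, rfl⟩
    | some w => exact ⟨some ⟨w, hw⟩, rfl⟩

/-- A path is not a cycle. -/
theorem IsGraphBall.not_isGraphSphere_one {W : Type*} {P : SimpleGraph W} (h : IsGraphBall 1 P) :
    ¬ IsGraphSphere 1 P := by
  intro hs
  obtain ⟨n, hn, ⟨e⟩⟩ := exists_pathGraph_iso_of_ball h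
  obtain ⟨m, hm, l, hl⟩ := exists_isCycleLabel hs
  -- The end of a path has one neighbour, while the labels `l x + 1` and `l x - 1` of a cycle of
  -- length at least four give two.
  have hadj : ∀ w, P.Adj (e.symm ⟨0, by omega⟩) w → (e w : ℕ) = 1 := by
    intro w hw
    rw [← e.map_adj_iff, pathGraph_adj] at hw
    simp at hw
    exact hw.symm
  set x := e.symm ⟨0, by omega⟩
  have h1 := hadj (l.symm (l x + 1)) ((hl _ _).2 (by simp))
  have h2 := hadj (l.symm (l x - 1)) ((hl _ _).2 (by simp))
  have h3 := l.symm.injective (e.injective (Fin.ext (h1.trans h2.symm)))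
  have h4 : ((2 : ℕ) : ZMod m) = 0 := by
    push_cast; linear_combination h3
  rw [ZMod.natCast_eq_zero_iff] at h4
  exact absurd (Nat.le_of_dvd (by norm_num) h4) (by omega)

theorem notMem_boundaryVertices {G : SimpleGraph V} {y : V} (hy : y ∈ interiorVertices G) :
    y ∉ boundaryVertices G :=
  fun h => IsGraphBall.not_isGraphSphere_one h hy

theorem IsGraphSphere.mem_boundaryVertices_iff (h : IsGraphSphere 2 H) {y : V} :
    y ∈ boundaryVertices (H.comap some) ↔ H.Adj none (some y) := by
  refine ⟨fun hy => ?_, h.mem_boundaryVertices⟩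
  by_contra hcon
  exact notMem_boundaryVertices (h.mem_interiorVertices hcon) hy

theorem IsGraphBall.interior_or_boundary {G : SimpleGraph V} (hG : IsGraphBall 2 G) (y : V) :
    y ∈ interiorVertices G ∨ y ∈ boundaryVertices G := by
  obtain ⟨H, h, rfl⟩ := hG
  by_cases hy : H.Adj none (some y)
  · exact .inr (h.mem_boundaryVertices hy)
  · exact .inl (h.mem_interiorVertices hy)

/-- An end point of an edge of a two-ball with two common neighbours for its end points is not in
the boundary if the other one is. -/
theorem IsGraphBall.notMem_boundaryVertices_of_common {G : SimpleGraph V} (hG : IsGraphBall 2 G)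
    {x y p q : V} (hy : y ∈ boundaryVertices G) (hpq : p ≠ q) (hxy : G.Adj x y)
    (hxp : G.Adj x p) (hyp : G.Adj y p) (hxq : G.Adj x q) (hyq : G.Adj y q) :
    x ∉ boundaryVertices G := by
  obtain ⟨H, h, rfl⟩ := hG
  rw [h.mem_boundaryVertices_iff] at hy ⊢
  intro hx
  -- In the sphere `x` and `y` have only two common neighbours, but `none`, `p` and `q` would be
  -- three.
  obtain ⟨a, b, -, hab⟩ := h.exists_common_neighbors hxy
  have h1 := (hab none).1 ⟨hx.symm, hy.symm⟩
  have h2 := (hab (some p)).1 ⟨hxp, hyp⟩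
  have h3 := (hab (some q)).1 ⟨hxq, hyq⟩
  have h4 : some p ≠ some q := by simpa using hpq
  have h5 : none ≠ some p := by simp
  have h6 : none ≠ some q := by simp
  grind

/-- A two-ball all of whose vertices have even degree has a boundary length divisible by three. -/
theorem IsGraphBall.three_dvd_boundaryLength [Finite V] {G : SimpleGraph V} (hG : IsGraphBall 2 G)
    (heven : ∀ y, Even (vertexDegree G y)) : 3 ∣ boundaryLength G := by
  classical
  have := Fintype.ofFinite V
  obtain ⟨H, h, rfl⟩ := hG
  have hcard : ∀ (P : Option V → Prop) [DecidablePred P], ¬ P none →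
      (Finset.univ.filter P).card = {u : V | P (some u)}.ncard := by
    intro P _ hP
    rw [← Set.ncard_image_of_injective _ (Option.some_injective V), ← Set.ncard_coe_finset]
    congr 1
    ext w
    cases w with
    | none => simp [hP]
    | some w => simp
  have h3 := h.three_dvd_card_neighbors none (by
    intro v hv
    cases v with
    | none => exact absurd rfl hv
    | some v =>
      rw [hcard _ (by simp)]
      have hv : {u | H.Adj (some v) (some u) ∧ some u ≠ none} = (H.comap some).neighborSet v := by
        ext u; simp
      rw [hv]
      exact heven v)
  rw [hcard _ (by simp)] at h3
  have hb : boundaryVertices (H.comap some) = {u | H.Adj none (some u)} :=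
    Set.ext fun u => h.mem_boundaryVertices_iff
  rwa [boundaryLength, hb]

end Ball

/-! ### The billiard permutation. -/

section Billiard

variable {V : Type*}

/-- In the unit sphere of `y`, the ray through `x` and `y` is continued to `z`. -/
def Continues (G : SimpleGraph V) (y : V) (x z : G.neighborSet y) : Prop :=
  (y ∈ interiorVertices G ∧ AntipodalInCycle (unitSphere G y) x z) ∨
    (y ∈ boundaryVertices G ∧ MirrorInPath (unitSphere G y) x z)

theorem continues_iff_mirror {G : SimpleGraph V} {y : V} (hy : y ∈ boundaryVertices G)
    (x z : G.neighborSet y) : Continues G y x z ↔ MirrorInPath (unitSphere G y) x z :=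
  ⟨fun h => h.elim (fun h => absurd hy (notMem_boundaryVertices h.1)) And.right,
    fun h => .inr ⟨hy, h⟩⟩

theorem continues_iff_antipodal {G : SimpleGraph V} {y : V} (hy : y ∈ interiorVertices G)
    (x z : G.neighborSet y) : Continues G y x z ↔ AntipodalInCycle (unitSphere G y) x z :=
  ⟨fun h => h.elim And.right fun h => absurd h.1 (notMem_boundaryVertices hy),
    fun h => .inl ⟨hy, h⟩⟩

theorem billiardStep_iff {G : SimpleGraph V} (a b : G.Dart) :
    BilliardStep G a b ↔ ∃ h : b.fst = a.snd,
      Continues G a.snd ⟨a.fst, a.adj.symm⟩ ⟨b.snd, by rw [← h]; exact b.adj⟩ := by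
  constructor
  · rintro ⟨x, y, z, hxy, hyz, rfl, rfl, h⟩
    exact ⟨rfl, h⟩
  · obtain ⟨⟨x, y⟩, hxy⟩ := a
    obtain ⟨⟨y', z⟩, hyz⟩ := b
    rintro ⟨h, hc⟩
    obtain rfl : y' = y := h
    exact ⟨x, y', z, hxy, hyz, rfl, rfl, hc⟩

/-- An even cyclic unit sphere carries a labelling by `ZMod (2 * k)`. -/
theorem exists_label_of_interior {G : SimpleGraph V} {y : V} (hy : y ∈ interiorVertices G)
    (heven : Even (vertexDegree G y)) :
    ∃ (k : ℕ) (_ : 2 ≤ k) (e : G.neighborSet y ≃ ZMod (2 * k)),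
      IsCycleLabel (unitSphere G y) e := by
  obtain ⟨m, hm, e, he⟩ := exists_isCycleLabel hy
  have hcard : vertexDegree G y = m := by
    have := Nat.card_congr e
    rwa [Nat.card_coe_set_eq, Nat.card_zmod] at this
  rw [hcard] at heven
  obtain ⟨k, rfl⟩ := heven.exists_two_nsmul m
  exact ⟨k, by simp at hm; omega, e, he⟩

theorem exists_iso_of_boundary {G : SimpleGraph V} {y : V} (hy : y ∈ boundaryVertices G) :
    3 ≤ vertexDegree G y ∧ Nonempty (unitSphere G y ≃g pathGraph (vertexDegree G y)) := by
  obtain ⟨n, hn, ⟨e⟩⟩ := exists_pathGraph_iso_of_ball hy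
  have hcard : vertexDegree G y = n := by
    have := Nat.card_congr e.toEquiv
    rwa [Nat.card_coe_set_eq, Nat.card_fin] at this
  rw [hcard]
  exact ⟨hn, ⟨e⟩⟩

/-- The continuation of rays at a vertex is an involution of its neighbours. -/
theorem IsGraphBall.exists_continuation {G : SimpleGraph V} (hG : IsGraphBall 2 G)
    (heven : ∀ y ∈ interiorVertices G, Even (vertexDegree G y)) (y : V) :
    ∃ τ : G.neighborSet y → G.neighborSet y, (∀ x z, Continues G y x z ↔ τ x = z) ∧
      ∀ x, τ (τ x) = x := by
  rcases hG.interior_or_boundary y with hy | hy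
  · obtain ⟨k, hk, e, he⟩ := exists_label_of_interior hy (heven y hy)
    refine ⟨fun x => e.symm (e x + k), fun x z => ?_, fun x => ?_⟩
    · rw [continues_iff_antipodal hy, he.antipodal_iff hk, e.symm_apply_eq, eq_comm]
    · have : (k : ZMod (2 * k)) + k = 0 := by
        rw [← two_mul]; exact_mod_cast ZMod.natCast_self (2 * k)
      beta_reduce
      rw [e.apply_symm_apply, add_assoc, this, add_zero, e.symm_apply_apply]
  · obtain ⟨-, ⟨e⟩⟩ := exists_iso_of_boundary hy
    refine ⟨fun x => e.symm (Fin.rev (e x)), fun x z => ?_, fun x => by simp⟩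
    rw [continues_iff_mirror hy, mirrorInPath_iff e, ← e.toEquiv.apply_eq_iff_eq]
    have h1 := (e x).2
    have h2 := (e z).2
    change _ ↔ e (e.symm _) = e z
    rw [e.apply_symm_apply, Fin.ext_iff, Fin.val_rev]
    omega

/-- A ray is reflected into itself only at boundary vertices of odd degree, in an interior edge. -/
theorem IsGraphBall.of_continues_self {G : SimpleGraph V} (hG : IsGraphBall 2 G)
    (heven : ∀ y ∈ interiorVertices G, Even (vertexDegree G y)) {y : V} {x : G.neighborSet y}
    (h : Continues G y x x) :
    y ∈ boundaryVertices G ∧ Odd (vertexDegree G y) ∧ (x : V) ∉ boundaryVertices G := by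
  rcases hG.interior_or_boundary y with hy | hy
  · obtain ⟨k, hk, e, he⟩ := exists_label_of_interior hy (heven y hy)
    -- The half turn `k` is not zero modulo `2 * k`, so an antipode is never the point itself.
    rw [continues_iff_antipodal hy, he.antipodal_iff hk, left_eq_add, ZMod.natCast_eq_zero_iff] at h
    exact absurd (Nat.le_of_dvd (by omega) h) (by omega)
  · obtain ⟨hn, ⟨e⟩⟩ := exists_iso_of_boundary hy
    rw [continues_iff_mirror hy, mirrorInPath_iff e] at h
    refine ⟨hy, ⟨e x, by omega⟩, ?_⟩
    -- As the middle of a path with at least three vertices, `x` has a neighbour on either side;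
    -- these are two common neighbours of `x` and `y`.
    have hadj : ∀ i : Fin (vertexDegree G y), ((e x : ℕ) + 1 = i ∨ (i : ℕ) + 1 = e x) → G.Adj x (e.symm i) := by
      intro i hi
      have : (unitSphere G y).Adj x (e.symm i) := by
        rw [← e.map_adj_iff, pathGraph_adj, e.apply_symm_apply]; exact hi
      exact this
    let p : Fin (vertexDegree G y) := ⟨e x - 1, by omega⟩
    let q : Fin (vertexDegree G y) := ⟨e x + 1, by omega⟩
    refine hG.notMem_boundaryVertices_of_common (p := e.symm p) (q := e.symm q) hy ?_ x.2.symm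
      (hadj p (.inr ?_)) (e.symm p).2 (hadj q (.inl rfl)) (e.symm q).2
    · intro hpq
      have := congrArg Fin.val (e.symm.injective (Subtype.ext hpq))
      simp only [p, q] at this
      omega
    · simp only [p]; omega

theorem existsUnique_continues_self {G : SimpleGraph V} {y : V} (hy : y ∈ boundaryVertices G)
    (hodd : Odd (vertexDegree G y)) : ∃! x, Continues G y x x := by
  obtain ⟨hn, ⟨e⟩⟩ := exists_iso_of_boundary hy
  obtain ⟨j, hj⟩ := hodd
  refine ⟨e.symm ⟨j, by omega⟩, ?_, fun x hx => ?_⟩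
  · simp only [continues_iff_mirror hy, mirrorInPath_iff e, e.apply_symm_apply]
    omega
  · beta_reduce at hx
    rw [continues_iff_mirror hy, mirrorInPath_iff e] at hx
    apply e.injective
    rw [e.apply_symm_apply]
    ext
    simp only
    omega

/-- The billiard step is a permutation of the directed edges, reversed by the reversal of edges. -/
theorem IsGraphBall.exists_billiardPerm {G : SimpleGraph V} (hG : IsGraphBall 2 G)
    (heven : ∀ y ∈ interiorVertices G, Even (vertexDegree G y)) :
    ∃ φ : Equiv.Perm G.Dart, (∀ a b, BilliardStep G a b ↔ φ a = b) ∧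
      ∀ a, (φ a).symm = φ⁻¹ a.symm := by
  choose τ hτ hinv using hG.exists_continuation heven
  let s : G.Dart → G.Dart := fun a =>
    ⟨(a.snd, τ a.snd ⟨a.fst, a.adj.symm⟩), (τ a.snd ⟨a.fst, a.adj.symm⟩).2⟩
  -- Since `τ` is an involution at each vertex, reversing, stepping and reversing undoes a step:
  -- this supplies both the inverse and the reversal relation.
  have hs : ∀ a, (s (s a).symm).symm = a := by
    intro a
    ext
    · exact congrArg Subtype.val (hinv a.snd ⟨a.fst, a.adj.symm⟩)
    · rfl
  let φ : Equiv.Perm G.Dart := ⟨s, fun a => (s a.symm).symm, hs, fun a => by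
    have := hs a.symm
    rw [← Dart.symm_symm (s _)]
    exact (congrArg Dart.symm this).trans (Dart.symm_symm a)⟩
  refine ⟨φ, fun a b => ?_, fun a => ?_⟩
  · rw [billiardStep_iff]
    constructor
    · rintro ⟨h, hc⟩
      rw [hτ] at hc
      ext
      · exact h.symm
      · exact congrArg Subtype.val hc
    · rintro rfl
      exact ⟨rfl, (hτ _ _ _).2 rfl⟩
  · change (s a).symm = (s a.symm.symm).symm
    rw [Dart.symm_symm]

theorem finite_dart [Finite V] (G : SimpleGraph V) : Finite G.Dart :=
  Finite.of_injective Dart.toProd Dart.toProd_injective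

/-- By finiteness, inverse iterates are also forward iterates, so forward reachability already fills
the whole cycle. -/
theorem orbitOf_eq_sameCycle [Finite V] {G : SimpleGraph V} {φ : Equiv.Perm G.Dart}
    (hφ : ∀ a b, BilliardStep G a b ↔ φ a = b) (a : G.Dart) :
    orbitOf G a = {b | φ.SameCycle a b} := by
  have := finite_dart G
  ext b
  constructor
  · intro h
    change Relation.ReflTransGen _ a b at h
    induction h with
    | refl => exact .refl _ _
    | tail _ hbc ih =>
      rw [hφ] at hbc
      rw [← hbc]
      exact Equiv.Perm.sameCycle_apply_right.2 ih
  · intro h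
    obtain ⟨i, -, rfl⟩ := Equiv.Perm.SameCycle.exists_pow_eq' h
    change Relation.ReflTransGen _ a _
    clear h
    induction i with
    | zero => exact .refl
    | succ i ih =>
      refine ih.tail ((hφ _ _).2 ?_)
      rw [pow_succ', Equiv.Perm.mul_apply]

end Billiard

/-! ### The three claims. -/

theorem mainTheorem7 {V : Type*} [Finite V] (G : SimpleGraph V) (hG : IsGraphBall 2 G)
    (heven : ∀ y ∈ interiorVertices G, Even (vertexDegree G y)) :
    (∃ φ : Equiv.Perm G.Dart, ∀ a b : G.Dart, BilliardStep G a b ↔ φ a = b) ∧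
    (¬ 3 ∣ boundaryLength G → (undirectedOrbits G).Nonempty ∧ ¬ IsErgodicBilliard G) ∧
    2 * (undirectedOrbits G).ncard =
      {y | y ∈ boundaryVertices G ∧ Odd (vertexDegree G y)}.ncard := by
  have := finite_dart G
  obtain ⟨φ, hφ, hsymm⟩ := hG.exists_billiardPerm heven
  have horbit := orbitOf_eq_sameCycle hφ
  have hne : ∀ a : G.Dart, a.symm ≠ a := fun a => a.symm_ne
  have hself : ∀ a : G.Dart, φ a = a.symm ↔
      Continues G a.snd ⟨a.fst, a.adj.symm⟩ ⟨a.fst, a.adj.symm⟩ := by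
    intro a
    rw [← hφ, billiardStep_iff]
    exact ⟨fun ⟨_, h⟩ => h, fun h => ⟨rfl, h⟩⟩
  -- Starting from an interior edge is no restriction: a stable orbit contains some `b` with `φ b =
  -- b.symm`, and the edge of `b` is interior.
  have hund : undirectedOrbits G =
      {O | (∃ a, O = {b | φ.SameCycle a b}) ∧ ∀ a ∈ O, a.symm ∈ O} := by
    ext O
    constructor
    · rintro ⟨⟨a, -, rfl⟩, h⟩
      exact ⟨⟨a, horbit a⟩, h⟩
    · rintro ⟨⟨a, rfl⟩, h⟩
      obtain ⟨b, hab, hb⟩ := exists_reversed_of_sameCycle φ Dart.symm hne hsymm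
        (h a (Equiv.Perm.SameCycle.refl _ _))
      refine ⟨⟨b, ⟨b.edge_mem, b.fst, Sym2.mem_mk_left _ _, ?_⟩, ?_⟩, h⟩
      · exact (hG.of_continues_self heven ((hself b).1 hb)).2.2
      · rw [horbit]
        ext c
        exact ⟨fun hc => hab.symm.trans hc, fun hc => hab.trans hc⟩
  have hcount : 2 * (undirectedOrbits G).ncard =
      {y | y ∈ boundaryVertices G ∧ Odd (vertexDegree G y)}.ncard := by
    rw [hund, two_mul_ncard_reversed_orbits φ Dart.symm hne hsymm]
    -- A reversed directed edge is determined by its head, whose path has a unique middle vertex.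
    refine Set.ncard_congr (fun a _ => a.snd) (fun a ha => ?_) (fun a b ha hb hab => ?_) ?_
    · obtain ⟨h1, h2, -⟩ := hG.of_continues_self heven ((hself a).1 ha)
      exact ⟨h1, h2⟩
    · obtain ⟨⟨x, y⟩, hxy⟩ := a
      obtain ⟨⟨x', y'⟩, hxy'⟩ := b
      obtain rfl : y = y' := hab
      have ha := (hself _).1 ha
      have hb := (hself _).1 hb
      obtain ⟨h1, h2, -⟩ := hG.of_continues_self heven ha
      have := (existsUnique_continues_self h1 h2).unique ha hb
      ext
      · exact congrArg Subtype.val this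
      · rfl
    · rintro y ⟨hy, hodd⟩
      obtain ⟨x, hx, -⟩ := existsUnique_continues_self hy hodd
      exact ⟨⟨(x, y), x.2.symm⟩, (hself _).2 hx, rfl⟩
  refine ⟨⟨φ, hφ⟩, fun h3 => ?_, hcount⟩
  have hnonempty : (undirectedOrbits G).Nonempty := by
    by_contra hempty
    rw [Set.not_nonempty_iff_eq_empty] at hempty
    rw [hempty, Set.ncard_empty, mul_zero, eq_comm, Set.ncard_eq_zero] at hcount
    refine h3 (hG.three_dvd_boundaryLength fun y => ?_)
    rcases hG.interior_or_boundary y with hy | hy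
    · exact heven y hy
    · by_contra hodd
      exact Set.eq_empty_iff_forall_notMem.1 hcount y ⟨hy, Nat.not_even_iff_odd.1 hodd⟩
  refine ⟨hnonempty, ?_⟩
  rintro ⟨O, ⟨a, -, rfl⟩, hO⟩
  obtain ⟨U, ⟨b, hb, rfl⟩, hU⟩ := hnonempty
  -- The undirected orbit of `b` contains both directions of its edge, so it shares `d` with the
  -- supposed ergodic orbit and coincides with it; then `d.symm` violates uniqueness.
  obtain ⟨d, ⟨hd, hdb⟩, huniq⟩ := hO b.edge hb
  rw [horbit] at hd hU
  have hdb' : φ.SameCycle b d := by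
    rcases (dart_edge_eq_iff _ _).1 hdb with rfl | rfl
    · exact .refl _ _
    · exact hU b (Equiv.Perm.SameCycle.refl _ _)
  have had : φ.SameCycle a d := hd
  refine hne d (huniq d.symm ⟨?_, by rw [Dart.edge_symm, hdb]⟩)
  rw [horbit]
  exact had.trans (hdb'.symm.trans (hU d hdb'))
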